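/- **Channel.** All alphabets are finite. In a discrete memoryless half-duplex multiple access relay channel, a block of $l=n+m$ channel uses consists of two slots. In the first slot ($n$ uses) the sources $S_1,S_2$ send $X_{11},X_{21}$, and the relay and the destination receive $Y_R$ and $Y_{11}$ according to $p(y_R,y_{11}\mid x_{11},x_{21})$. In the second slot ($m$ uses) the sources and the relay send $X_{12},X_{22},X_R$ and the destination receives $Y_{12}$ according to $p(y_{12}\mid x_{12},x_{22},x_R)$. Source $S_i$ has a message $W_i$, uniform on a set of $\lceil 2^{lR_i}\rceil$ elements, $W_1$ and $W_2$ independent, and sends codewords $x_{i1}^n(W_i)$ and $x_{i2}^m(W_i)$ in the two slots. The relay's input in the second slot is a function of $Y_R^n$. The destination computes $(\hat W_1,\hat W_2)$ from $(Y_{11}^n,Y_{12}^m)$ or declares a failure, and the error probability is the probability that it does not output $(W_1,W_2)$. **GQF scheme.** Fix $p(x_{11})p(x_{21})p(x_{12})p(x_{22})p(x_R)p(\hat y_R\mid y_R)$. A generalized quantize-and-forward (GQF) code with quantization rate $R_U\ge 0$ and typicality parameters $\epsilon'<\epsilon$ is a code for which there are sequences $\hat y_R^n(u)$ and $x_R^m(u)$,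 $1\le u\le\lceil 2^{lR_U}\rceil$, such that: the relay selects an index $u$ with $(y_R^n,\hat y_R^n(u))$ jointly $\epsilon'$-typical, if there is one (an arbitrary index otherwise), and sends $x_R^m(u)$; the destination outputs the unique pair $(w_1,w_2)$ for which, for some $u$, both $(x_{11}^n(w_1),x_{21}^n(w_2),y_{11}^n,\hat y_R^n(u))$ and $(x_{12}^m(w_1),x_{22}^m(w_2),x_R^m(u),y_{12}^m)$ are jointly $\epsilon$-typical, and declares a failure if there is no unique such pair. Here $x^n$ is $\epsilon$-typical for a pmf $p$ if the relative frequency of every letter $a$ in $x^n$ differs from $p(a)$ by at most $\epsilon\,p(a)$. **Theorem.** Let $0<\beta<1$, let $p(x_{11})p(x_{21})p(x_{12})p(x_{22})p(x_R)p(\hat y_R\mid y_R)$ be any input distribution, and let $R_1,R_2\ge 0$ satisfy $$R_i<\min\{a_1(i),b_1(i)\}\quad(i=1,2),\qquad R_1+R_2<\min\{c_1,d_1\},$$ where, with $j\in\{1,2\}$, $j\ne i$, and mutual informations in bits, $$a_1(i)=\beta I(X_{i1};X_{j1},Y_{11},\hat Y_R)+(1-\beta)I(X_{i2};X_{j2},X_R,Y_{12}),$$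 $$b_1(i)=\beta\,[I(X_{i1};X_{j1},Y_{11})-I(\hat Y_R;Y_R\mid X_{i1},X_{j1},Y_{11})]+(1-\beta)I(X_{i2},X_R;X_{j2},Y_{12}),$$ $$c_1=\beta I(X_{11},X_{21};Y_{11},\hat Y_R)+(1-\beta)I(X_{12},X_{22};X_R,Y_{12}),$$ $$d_1=\beta\,[I(X_{11},X_{21},\hat Y_R;Y_{11})+I(X_{11},X_{21};\hat Y_R)-I(Y_R;\hat Y_R)]+(1-\beta)I(X_{12},X_{22},X_R;Y_{12}).$$ Then $(R_1,R_2)$ is achievable by the GQF scheme: there are $R_U\ge 0$ and $0<\epsilon'<\epsilon<1$ such that, for all sequences of slot lengths $(n,m)$ with $l=n+m\to\infty$ and $n/l\to\beta$ (in particular if $n=\beta l$), there are GQF codes with these parameters and with $\lceil 2^{lR_i}\rceil$ messages for source $i$ whose error probabilities tend to $0$. -/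

import Mathlib

open Filter Topology

noncomputable section

namespace HDMARC

/-! ### Finite information measures (in bits) -/

section Information

variable {Ω α β γ : Type*} [Fintype Ω]

open Classical in
/-- The pmf of the random variable `f` when the sample point has pmf `p`. -/
def law (p : Ω → ℝ) (f : Ω → α) (a : α) : ℝ :=
  ∑ ω, if f ω = a then p ω else 0

/-- Shannon entropy `H(f)` in bits of the random variable `f` under the pmf `p`. -/
def entropy [Fintype α] (p : Ω → ℝ) (f : Ω → α) : ℝ :=
  (∑ a, Real.negMulLog (law p f a)) / Real.log 2

/-- Mutual information `I(f; g)` in bits. -/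
def mutualInfo [Fintype α] [Fintype β] (p : Ω → ℝ) (f : Ω → α) (g : Ω → β) : ℝ :=
  entropy p f + entropy p g - entropy p (fun ω => (f ω, g ω))

/-- Conditional mutual information `I(f; g | h)` in bits. -/
def condMutualInfo [Fintype α] [Fintype β] [Fintype γ]
    (p : Ω → ℝ) (f : Ω → α) (g : Ω → β) (h : Ω → γ) : ℝ :=
  entropy p (fun ω => (f ω, h ω)) + entropy p (fun ω => (g ω, h ω))
    - entropy p (fun ω => (f ω, g ω, h ω)) - entropy p h

open Classical in
/-- Strongly (robustly) `ε`-typical sequences of length `n` for the pmf `p`: the relative frequency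
of every letter `a` differs from `p a` by at most `ε * p a`. -/
def typicalSet (p : α → ℝ) (ε : ℝ) (n : ℕ) : Set (Fin n → α) :=
  {x | ∀ a, |((Finset.univ.filter fun i => x i = a).card : ℝ) / n - p a| ≤ ε * p a}

end Information

/-! ### The channel, the input distribution and codes -/

/-- A discrete memoryless half-duplex multiple access relay channel with finite alphabets.
In the first slot the sources send `x₁₁`, `x₂₁`, the relay receives `y_R` and the destination
receives `y₁₁`; in the second slot the sources and the relay send `x₁₂`, `x₂₂`, `x_R` and the
destination receives `y₁₂`. -/
structure Channel (X11 X21 X12 X22 XR YR Y11 Y12 : Type*)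
    [Fintype YR] [Fintype Y11] [Fintype Y12] where
  /-- `p(y_R, y₁₁ | x₁₁, x₂₁)` -/
  slot1 : X11 → X21 → YR × Y11 → ℝ
  /-- `p(y₁₂ | x₁₂, x₂₂, x_R)` -/
  slot2 : X12 → X22 → XR → Y12 → ℝ
  slot1_mem : ∀ x11 x21, slot1 x11 x21 ∈ stdSimplex ℝ (YR × Y11)
  slot2_mem : ∀ x12 x22 xR, slot2 x12 x22 xR ∈ stdSimplex ℝ Y12

/-- An input distribution `p(x₁₁) p(x₂₁) p(x₁₂) p(x₂₂) p(x_R) p(ŷ_R | y_R)`; the letters of the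
alphabet `YQ` are the values `ŷ_R` of the quantizer. -/
structure InputDist (X11 X21 X12 X22 XR YR YQ : Type*)
    [Fintype X11] [Fintype X21] [Fintype X12] [Fintype X22] [Fintype XR] [Fintype YQ] where
  p11 : X11 → ℝ
  p21 : X21 → ℝ
  p12 : X12 → ℝ
  p22 : X22 → ℝ
  pR : XR → ℝ
  /-- `p(ŷ_R | y_R)` -/
  quant : YR → YQ → ℝ
  p11_mem : p11 ∈ stdSimplex ℝ X11
  p21_mem : p21 ∈ stdSimplex ℝ X21
  p12_mem : p12 ∈ stdSimplex ℝ X12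
  p22_mem : p22 ∈ stdSimplex ℝ X22
  pR_mem : pR ∈ stdSimplex ℝ XR
  quant_mem : ∀ y, quant y ∈ stdSimplex ℝ YQ

section Model

variable {X11 X21 X12 X22 XR YR Y11 Y12 YQ : Type*}
  [Fintype X11] [Fintype X21] [Fintype X12] [Fintype X22] [Fintype XR]
  [Fintype YR] [Fintype Y11] [Fintype Y12] [Fintype YQ]

/-- The joint pmf of `(X₁₁, X₂₁, Y_R, Y₁₁, Ŷ_R)`. -/
def joint1 (ch : Channel X11 X21 X12 X22 XR YR Y11 Y12) (d : InputDist X11 X21 X12 X22 XR YR YQ) :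
    X11 × X21 × YR × Y11 × YQ → ℝ :=
  fun (x11, x21, yR, y11, q) =>
    d.p11 x11 * d.p21 x21 * ch.slot1 x11 x21 (yR, y11) * d.quant yR q

/-- The joint pmf of `(X₁₂, X₂₂, X_R, Y₁₂)`. -/
def joint2 (ch : Channel X11 X21 X12 X22 XR YR Y11 Y12) (d : InputDist X11 X21 X12 X22 XR YR YQ) :
    X12 × X22 × XR × Y12 → ℝ :=
  fun (x12, x22, xR, y12) =>
    d.p12 x12 * d.p22 x22 * d.pR xR * ch.slot2 x12 x22 xR y12

/-- `a₁(1) = β I(X₁₁; X₂₁, Y₁₁, Ŷ_R) + (1-β) I(X₁₂; X₂₂, X_R, Y₁₂)`. -/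
def boundA1 (ch : Channel X11 X21 X12 X22 XR YR Y11 Y12)
    (d : InputDist X11 X21 X12 X22 XR YR YQ) (β : ℝ) : ℝ :=
  β * mutualInfo (joint1 ch d) (fun (x11, _, _, _, _) => x11)
      (fun (_, x21, _, y11, q) => (x21, y11, q))
    + (1 - β) * mutualInfo (joint2 ch d) (fun (x12, _, _, _) => x12)
      (fun (_, x22, xR, y12) => (x22, xR, y12))

/-- `a₁(2) = β I(X₂₁; X₁₁, Y₁₁, Ŷ_R) + (1-β) I(X₂₂; X₁₂, X_R, Y₁₂)`. -/
def boundA2 (ch : Channel X11 X21 X12 X22 XR YR Y11 Y12)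
    (d : InputDist X11 X21 X12 X22 XR YR YQ) (β : ℝ) : ℝ :=
  β * mutualInfo (joint1 ch d) (fun (_, x21, _, _, _) => x21)
      (fun (x11, _, _, y11, q) => (x11, y11, q))
    + (1 - β) * mutualInfo (joint2 ch d) (fun (_, x22, _, _) => x22)
      (fun (x12, _, xR, y12) => (x12, xR, y12))

/-- `b₁(1) = β [I(X₁₁; X₂₁, Y₁₁) - I(Ŷ_R; Y_R | X₁₁, X₂₁, Y₁₁)] + (1-β) I(X₁₂, X_R; X₂₂, Y₁₂)`. -/
def boundB1 (ch : Channel X11 X21 X12 X22 XR YR Y11 Y12)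
    (d : InputDist X11 X21 X12 X22 XR YR YQ) (β : ℝ) : ℝ :=
  β * (mutualInfo (joint1 ch d) (fun (x11, _, _, _, _) => x11)
        (fun (_, x21, _, y11, _) => (x21, y11))
      - condMutualInfo (joint1 ch d) (fun (_, _, _, _, q) => q) (fun (_, _, yR, _, _) => yR)
        (fun (x11, x21, _, y11, _) => (x11, x21, y11)))
    + (1 - β) * mutualInfo (joint2 ch d) (fun (x12, _, xR, _) => (x12, xR))
      (fun (_, x22, _, y12) => (x22, y12))

/-- `b₁(2) = β [I(X₂₁; X₁₁, Y₁₁) - I(Ŷ_R; Y_R | X₂₁, X₁₁, Y₁₁)] + (1-β) I(X₂₂, X_R; X₁₂, Y₁₂)`. -/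
def boundB2 (ch : Channel X11 X21 X12 X22 XR YR Y11 Y12)
    (d : InputDist X11 X21 X12 X22 XR YR YQ) (β : ℝ) : ℝ :=
  β * (mutualInfo (joint1 ch d) (fun (_, x21, _, _, _) => x21)
        (fun (x11, _, _, y11, _) => (x11, y11))
      - condMutualInfo (joint1 ch d) (fun (_, _, _, _, q) => q) (fun (_, _, yR, _, _) => yR)
        (fun (x11, x21, _, y11, _) => (x21, x11, y11)))
    + (1 - β) * mutualInfo (joint2 ch d) (fun (_, x22, xR, _) => (x22, xR))
      (fun (x12, _, _, y12) => (x12, y12))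

/-- `c₁ = β I(X₁₁, X₂₁; Y₁₁, Ŷ_R) + (1-β) I(X₁₂, X₂₂; X_R, Y₁₂)`. -/
def boundC (ch : Channel X11 X21 X12 X22 XR YR Y11 Y12)
    (d : InputDist X11 X21 X12 X22 XR YR YQ) (β : ℝ) : ℝ :=
  β * mutualInfo (joint1 ch d) (fun (x11, x21, _, _, _) => (x11, x21))
      (fun (_, _, _, y11, q) => (y11, q))
    + (1 - β) * mutualInfo (joint2 ch d) (fun (x12, x22, _, _) => (x12, x22))
      (fun (_, _, xR, y12) => (xR, y12))

/-- `d₁ = β [I(X₁₁, X₂₁, Ŷ_R; Y₁₁) + I(X₁₁, X₂₁; Ŷ_R) - I(Y_R; Ŷ_R)]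
+ (1-β) I(X₁₂, X₂₂, X_R; Y₁₂)`. -/
def boundD (ch : Channel X11 X21 X12 X22 XR YR Y11 Y12)
    (d : InputDist X11 X21 X12 X22 XR YR YQ) (β : ℝ) : ℝ :=
  β * (mutualInfo (joint1 ch d) (fun (x11, x21, _, _, q) => (x11, x21, q))
        (fun (_, _, _, y11, _) => y11)
      + mutualInfo (joint1 ch d) (fun (x11, x21, _, _, _) => (x11, x21))
        (fun (_, _, _, _, q) => q)
      - mutualInfo (joint1 ch d) (fun (_, _, yR, _, _) => yR) (fun (_, _, _, _, q) => q))
    + (1 - β) * mutualInfo (joint2 ch d) (fun (x12, x22, xR, _) => (x12, x22, xR))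
      (fun (_, _, _, y12) => y12)

/-- A block code: message sets `Fin M1`, `Fin M2`, slots of `n` and `m` channel uses. The relay
only listens in the first slot and its input in the second slot is a function of what it heard.
The decoder returns a pair of messages, or `none` when it declares a failure. -/
structure Code (X11 X21 X12 X22 XR YR Y11 Y12 : Type*) (n m M1 M2 : ℕ) where
  enc11 : Fin M1 → Fin n → X11
  enc12 : Fin M1 → Fin m → X12
  enc21 : Fin M2 → Fin n → X21
  enc22 : Fin M2 → Fin m → X22
  relay : (Fin n → YR) → Fin m → XR
  dec : (Fin n → Y11) → (Fin m → Y12) → Option (Fin M1 × Fin M2)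

/-- `Pr(Ŵ₁ ≠ W₁ or Ŵ₂ ≠ W₂)` for independent, uniformly distributed messages over the memoryless
channel; a declared failure is an error. -/
def Code.errorProb (ch : Channel X11 X21 X12 X22 XR YR Y11 Y12) {n m M1 M2 : ℕ}
    (C : Code X11 X21 X12 X22 XR YR Y11 Y12 n m M1 M2) : ℝ :=
  (1 / ((M1 : ℝ) * (M2 : ℝ))) * ∑ w1 : Fin M1, ∑ w2 : Fin M2,
    ∑ yR : Fin n → YR, ∑ y11 : Fin n → Y11, ∑ y12 : Fin m → Y12,
      (∏ i, ch.slot1 (C.enc11 w1 i) (C.enc21 w2 i) (yR i, y11 i)) *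
      (∏ i, ch.slot2 (C.enc12 w1 i) (C.enc22 w2 i) (C.relay yR i) (y12 i)) *
      (if C.dec y11 y12 = some (w1, w2) then 0 else 1)

/-! ### The generalized quantize-and-forward scheme -/

/-- The decoding test of the scheme with quantization codebook `cq` and relay codebook `cR`: the
codewords of the message pair `w` are jointly `ε`-typical with the received sequences in both
slots, for some common quantization index `u`. -/
def DecodingTest (ch : Channel X11 X21 X12 X22 XR YR Y11 Y12)
    (d : InputDist X11 X21 X12 X22 XR YR YQ) (ε : ℝ) {n m M1 M2 MU : ℕ}
    (C : Code X11 X21 X12 X22 XR YR Y11 Y12 n m M1 M2)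
    (cq : Fin MU → Fin n → YQ) (cR : Fin MU → Fin m → XR)
    (y11 : Fin n → Y11) (y12 : Fin m → Y12) (w : Fin M1 × Fin M2) : Prop :=
  ∃ u : Fin MU,
    (fun i => (C.enc11 w.1 i, C.enc21 w.2 i, y11 i, cq u i)) ∈
      typicalSet (law (joint1 ch d) fun (x11, x21, _, y11, q) => (x11, x21, y11, q)) ε n ∧
    (fun i => (C.enc12 w.1 i, C.enc22 w.2 i, cR u i, y12 i)) ∈ typicalSet (joint2 ch d) ε m

/-- `C` is a generalized quantize-and-forward (GQF) code with `MU` quantization indices and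
typicality parameters `ε'` (relay) and `ε` (destination). There are codebooks `ŷ_R^n(u)` and
`x_R^m(u)` and an index selection rule `sel` such that
* `sel y` is an index whose quantization codeword is jointly `ε'`-typical with the relay's
  observation `y`, whenever there is one;
* the relay sends `x_R^m(sel y)`, without binning;
* the destination outputs the unique message pair that passes the joint typicality test of both
  slots, without decoding the index, and declares a failure if there is no unique such pair. -/
def Code.IsGQF (ch : Channel X11 X21 X12 X22 XR YR Y11 Y12)
    (d : InputDist X11 X21 X12 X22 XR YR YQ) (ε' ε : ℝ) (MU : ℕ) {n m M1 M2 : ℕ}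
    (C : Code X11 X21 X12 X22 XR YR Y11 Y12 n m M1 M2) : Prop :=
  ∃ (cq : Fin MU → Fin n → YQ) (cR : Fin MU → Fin m → XR) (sel : (Fin n → YR) → Fin MU),
    (∀ y : Fin n → YR,
      (∃ u, (fun i => (y i, cq u i)) ∈
        typicalSet (law (joint1 ch d) fun (_, _, yR, _, q) => (yR, q)) ε' n) →
      (fun i => (y i, cq (sel y) i)) ∈
        typicalSet (law (joint1 ch d) fun (_, _, yR, _, q) => (yR, q)) ε' n) ∧
    (∀ y, C.relay y = cR (sel y)) ∧
    (∀ y11 y12 w, C.dec y11 y12 = some w ↔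
      ∀ w', DecodingTest ch d ε C cq cR y11 y12 w' ↔ w' = w)

/-- The number `⌈2^(lR)⌉` of messages of a code of rate `R` and block length `l`. -/
def numMessages (l : ℕ) (R : ℝ) : ℕ := ⌈(2 : ℝ) ^ ((l : ℝ) * R)⌉₊

/-- The rate pair `(R1, R2)` is achieved by the GQF scheme with the input distribution `d` and
first-slot fraction `β`: for a quantization rate `RU` and typicality parameters `ε' < ε` fixed in
advance, and for all slot lengths `n k`, `m k` with `l = n k + m k → ∞` and `n k / l → β` (in
particular when `n k = β * l`), there are GQF codes with `⌈2^(l*R1)⌉` and `⌈2^(l*R2)⌉` messages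
whose error probability tends to `0`. -/
def AchievableByGQF (ch : Channel X11 X21 X12 X22 XR YR Y11 Y12)
    (d : InputDist X11 X21 X12 X22 XR YR YQ) (β R1 R2 : ℝ) : Prop :=
  ∃ RU ε' ε : ℝ, 0 ≤ RU ∧ 0 < ε' ∧ ε' < ε ∧ ε < 1 ∧
    ∀ n m : ℕ → ℕ,
      Tendsto (fun k => n k + m k) atTop atTop →
      Tendsto (fun k => (n k : ℝ) / ((n k + m k : ℕ) : ℝ)) atTop (𝓝 β) →
      ∃ C : ∀ k, Code X11 X21 X12 X22 XR YR Y11 Y12 (n k) (m k)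
          (numMessages (n k + m k) R1) (numMessages (n k + m k) R2),
        (∀ k, (C k).IsGQF ch d ε' ε (numMessages (n k + m k) RU)) ∧
        Tendsto (fun k => (C k).errorProb ch) atTop (𝓝 0)

end Model

end HDMARC

end

/-! The code is drawn at random: all codewords are independent with i.i.d. letters, the two slots
use independent codebooks, and the quantization letters have the law of Ŷ_R. For each message pair
the failure probability, averaged over the codebooks, is estimated by a union bound
(`expect_failure_le`, applied in `expect_failureProb_le`); some choice of codebooks does at least as
well as the average (`exists_isGQF_errorProb_le`).

There are four causes of failure. The relay may find no typical index; this is covering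
(`eventually_expect_covering_le`) and is rare if R_U > β I(Y_R; Ŷ_R). The relay may succeed while
the true first-slot sequences fail the test; given y_R^n the quantization sequence is determined and
the other letters are independent, so Chebyshev suffices (`expect_relayTest_not_firstTest_le`). The
true second-slot sequences may be atypical, again Chebyshev. Finally a wrong message pair may pass
both tests with a common index. If that index is the relay's, only the wrong source codewords are
fresh; otherwise the two auxiliary codewords are fresh too, at the price of a factor counting the
indices. Each slot contributes one factor, bounded by `eventually_expect_typical_le`, and the
exponents of the slots add with weights β and 1 - β.

For r equal to R₁, R₂ or R₁ + R₂ this requires r < β `firstSame` + (1 - β) `secondSame` and r + R_U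
< β `firstDiff` + (1 - β) `secondDiff`. Taking R_U slightly above β I(Y_R; Ŷ_R) eliminates it. The
packing exponents agree with a₁, b₁, c₁, d₁ by entropy bookkeeping; for b₁ this uses the Markov
chain Ŷ_R – Y_R – (X₁₁, X₂₁, Y₁₁), in the form of `entropy_joint1`. -/

open Filter Topology

noncomputable section

namespace HDMARC

/-! ### Finite expectations -/

section Expectation

variable {α β ι : Type*} [Fintype α] [Fintype β] [Fintype ι]
  [DecidableEq ι]

/-- The expectation of `f` under the weights `p`. -/
def expect (p f : α → ℝ) : ℝ := ∑ a, p a * f a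

open Classical in
/-- The indicator of a proposition. -/
def ind (P : Prop) : ℝ := if P then 1 else 0

/-- The joint pmf of a first coordinate with pmf `p` and a second one with conditional pmf `k`. -/
def joinPmf (p : α → ℝ) (k : α → β → ℝ) : α × β → ℝ := fun z => p z.1 * k z.1 z.2

/-- The product of the weights `p i`. -/
def prodPmf (p : ι → α → ℝ) : (ι → α) → ℝ := fun x => ∏ i, p i (x i)

lemma ind_nonneg (P : Prop) : 0 ≤ ind P := by unfold ind; split_ifs <;> norm_num

lemma ind_le_one (P : Prop) : ind P ≤ 1 := by unfold ind; split_ifs <;> norm_num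

lemma ind_of {P : Prop} (h : P) : ind P = 1 := by simp [ind, h]

lemma ind_of_not {P : Prop} (h : ¬P) : ind P = 0 := by simp [ind, h]

lemma ind_mono {P Q : Prop} (h : P → Q) : ind P ≤ ind Q := by
  by_cases hP : P
  · rw [ind_of hP, ind_of (h hP)]
  · rw [ind_of_not hP]; exact ind_nonneg Q

lemma ind_and (P Q : Prop) : ind (P ∧ Q) = ind P * ind Q := by
  by_cases hP : P <;> by_cases hQ : Q <;> simp [ind, hP, hQ]

lemma ind_not (P : Prop) : ind (¬P) = 1 - ind P := by
  by_cases hP : P <;> simp [ind, hP]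

lemma ind_or_le (P Q : Prop) : ind (P ∨ Q) ≤ ind P + ind Q := by
  by_cases hP : P <;> by_cases hQ : Q <;> simp [ind, hP, hQ]

lemma ind_exists_le (P : α → Prop) : ind (∃ a, P a) ≤ ∑ a, ind (P a) := by
  by_cases h : ∃ a, P a
  · obtain ⟨a, ha⟩ := h
    calc ind (∃ a, P a) ≤ 1 := ind_le_one _
      _ = ind (P a) := (ind_of ha).symm
      _ ≤ ∑ a, ind (P a) :=
          Finset.single_le_sum (f := fun a => ind (P a)) (fun a _ => ind_nonneg _)
            (Finset.mem_univ a)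
  · rw [ind_of_not h]; exact Finset.sum_nonneg fun a _ => ind_nonneg _

lemma expect_mono {p : α → ℝ} (hp : ∀ a, 0 ≤ p a) {f g : α → ℝ} (h : ∀ a, f a ≤ g a) :
    expect p f ≤ expect p g :=
  Finset.sum_le_sum fun a _ => mul_le_mul_of_nonneg_left (h a) (hp a)

lemma expect_nonneg {p : α → ℝ} (hp : ∀ a, 0 ≤ p a) {f : α → ℝ} (h : ∀ a, 0 ≤ f a) :
    0 ≤ expect p f :=
  Finset.sum_nonneg fun a _ => mul_nonneg (hp a) (h a)

lemma expect_const {p : α → ℝ} (hp : p ∈ stdSimplex ℝ α) (c : ℝ) : expect p (fun _ => c) = c := by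
  rw [expect, ← Finset.sum_mul, hp.2, one_mul]

lemma expect_le {p : α → ℝ} (hp : p ∈ stdSimplex ℝ α) {f : α → ℝ} {c : ℝ} (h : ∀ a, f a ≤ c) :
    expect p f ≤ c :=
  (expect_mono hp.1 h).trans_eq (expect_const hp c)

lemma exists_le_of_expect_le {p : α → ℝ} (hp : p ∈ stdSimplex ℝ α) {f : α → ℝ} {c : ℝ}
    (h : expect p f ≤ c) : ∃ a, f a ≤ c := by
  by_contra! hc
  have h0 : ∀ a, 0 ≤ p a * (f a - c) := fun a => mul_nonneg (hp.1 a) (by linarith [hc a])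
  have h1 : ∑ a, p a * (f a - c) = expect p f - c := by
    simp only [mul_sub, Finset.sum_sub_distrib, ← Finset.sum_mul, hp.2, expect, one_mul]
  have h2 : ∑ a, p a * (f a - c) = 0 :=
    le_antisymm (by linarith) (Finset.sum_nonneg fun a _ => h0 a)
  rw [Finset.sum_eq_zero_iff_of_nonneg fun a _ => h0 a] at h2
  have h3 : ∑ a, p a = 0 := Finset.sum_eq_zero fun a ha => by
    rcases mul_eq_zero.1 (h2 a ha) with h | h
    · exact h
    · linarith [hc a]
  linarith [hp.2]

lemma expect_add (p f g : α → ℝ) : expect p (fun a => f a + g a) = expect p f + expect p g := by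
  simp [expect, mul_add, Finset.sum_add_distrib]

lemma expect_sub (p f g : α → ℝ) : expect p (fun a => f a - g a) = expect p f - expect p g := by
  simp [expect, mul_sub, Finset.sum_sub_distrib]

lemma expect_mul_right (p f : α → ℝ) (c : ℝ) : expect p (fun a => f a * c) = expect p f * c := by
  simp only [expect, Finset.sum_mul, mul_assoc]

lemma expect_mul_left (p f : α → ℝ) (c : ℝ) : expect p (fun a => c * f a) = c * expect p f := by
  simp only [expect, Finset.mul_sum]
  exact Finset.sum_congr rfl fun a _ => by ring

lemma expect_sum {γ : Type*} (p : α → ℝ) (s : Finset γ) (f : γ → α → ℝ) :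
    expect p (fun a => ∑ i ∈ s, f i a) = ∑ i ∈ s, expect p (f i) := by
  simp only [expect, Finset.mul_sum]
  exact Finset.sum_comm

lemma expect_comm (p : α → ℝ) (q : β → ℝ) (f : α → β → ℝ) :
    expect p (fun a => expect q (f a)) = expect q (fun b => expect p (fun a => f a b)) := by
  simp only [expect, Finset.mul_sum]
  rw [Finset.sum_comm]
  exact Finset.sum_congr rfl fun _ _ => Finset.sum_congr rfl fun _ _ => by ring

lemma expect_swap_le {p : α → ℝ} {q : β → ℝ} (hq : q ∈ stdSimplex ℝ β) {f : α → β → ℝ} {c : ℝ}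
    (h : ∀ b, expect p (fun a => f a b) ≤ c) : expect p (fun a => expect q (f a)) ≤ c := by
  rw [expect_comm]
  exact expect_le hq h

lemma expect_joinPmf (p : α → ℝ) (k : α → β → ℝ) (f : α × β → ℝ) :
    expect (joinPmf p k) f = expect p (fun a => expect (k a) (fun b => f (a, b))) := by
  simp only [expect, joinPmf, Fintype.sum_prod_type, Finset.mul_sum, mul_assoc]

lemma joinPmf_mem {p : α → ℝ} {k : α → β → ℝ} (hp : p ∈ stdSimplex ℝ α)
    (hk : ∀ a, k a ∈ stdSimplex ℝ β) : joinPmf p k ∈ stdSimplex ℝ (α × β) := by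
  refine ⟨fun z => mul_nonneg (hp.1 _) ((hk _).1 _), ?_⟩
  simp [joinPmf, Fintype.sum_prod_type, ← Finset.mul_sum, (hk _).2, hp.2]

lemma expect_prodPmf_prod (p : ι → α → ℝ) (f : ι → α → ℝ) :
    expect (prodPmf p) (fun x => ∏ i, f i (x i)) = ∏ i, expect (p i) (f i) := by
  simp only [expect, prodPmf, ← Finset.prod_mul_distrib]
  rw [Fintype.prod_sum]

lemma prodPmf_mem {p : ι → α → ℝ} (hp : ∀ i, p i ∈ stdSimplex ℝ α) :
    prodPmf p ∈ stdSimplex ℝ (ι → α) := by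
  refine ⟨fun x => Finset.prod_nonneg fun i _ => (hp i).1 _, ?_⟩
  simp only [prodPmf]
  rw [← Fintype.prod_sum fun i a => p i a]
  simp [(hp _).2]

/-- Memorylessness: independent input–output pairs are an independent input sequence sent letterwise
through the kernels. It passes between joint letters and separate sequences. -/
lemma expect_prodPmf_joinPmf (p : ι → α → ℝ) (k : ι → α → β → ℝ) (f : (ι → α) → (ι → β) → ℝ) :
    expect (prodPmf fun i => joinPmf (p i) (k i)) (fun z => f (fun i => (z i).1) fun i => (z i).2) =
      expect (prodPmf p) (fun x => expect (prodPmf fun i => k i (x i)) (f x)) := by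
  rw [← expect_joinPmf (prodPmf p) (fun x => prodPmf fun i => k i (x i)) (fun z => f z.1 z.2)]
  refine Fintype.sum_equiv (Equiv.arrowProdEquivProdArrow ι (fun _ => α) (fun _ => β)) _ _ ?_
  intro z
  simp [joinPmf, prodPmf, Finset.prod_mul_distrib, Equiv.arrowProdEquivProdArrow]

lemma expect_prodPmf_split (p : α → ℝ) (w : ι) (f : (ι → α) → ℝ) :
    expect (prodPmf fun _ : ι => p) f =
      expect p (fun a => expect (prodPmf fun _ : {j // j ≠ w} => p)
        (fun x => f ((Equiv.funSplitAt w α).symm (a, x)))) := by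
  rw [← expect_joinPmf p (fun _ => prodPmf fun _ : {j // j ≠ w} => p)
    (fun z => f ((Equiv.funSplitAt w α).symm z))]
  refine Fintype.sum_equiv (Equiv.funSplitAt w α) _ _ ?_
  intro x
  simp only [Equiv.symm_apply_apply]
  congr 1
  simp only [prodPmf, joinPmf, Equiv.funSplitAt, Equiv.piSplitAt_apply]
  exact Fintype.prod_eq_mul_prod_subtype_ne (fun i => p (x i)) w

lemma expect_prodPmf_eval {p : ι → α → ℝ} (hp : ∀ i, p i ∈ stdSimplex ℝ α) (i : ι)
    (f : α → ℝ) : expect (prodPmf p) (fun x => f (x i)) = expect (p i) f := by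
  have h := expect_prodPmf_prod p (fun j a => if j = i then f a else 1)
  have h1 : ∀ x : ι → α, ∏ j, (if j = i then f (x j) else 1) = f (x i) := fun x => by simp
  simp only [h1] at h
  rw [h, ← Finset.mul_prod_erase _ _ (Finset.mem_univ i), Finset.prod_eq_one, mul_one]
  · simp
  · intro j hj
    simp only [(Finset.mem_erase.1 hj).1, if_false]
    exact expect_const (hp j) 1

lemma expect_prodPmf_eval₂ {p : α → ℝ} (hp : p ∈ stdSimplex ℝ α) {w w' : ι} (h : w' ≠ w)
    (f : α → α → ℝ) :
    expect (prodPmf fun _ : ι => p) (fun x => f (x w) (x w')) =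
      expect p (fun a => expect p (fun b => f a b)) := by
  rw [expect_prodPmf_split p w]
  simp only [Equiv.funSplitAt, Equiv.piSplitAt_symm_apply, dite_true, h, dite_false]
  congr 1; funext a
  exact expect_prodPmf_eval (fun _ => hp) (⟨w', h⟩ : {j // j ≠ w}) (fun b => f a b)

lemma expect_prodPmf_mul {p : ι → α → ℝ} (hp : ∀ i, p i ∈ stdSimplex ℝ α) {i j : ι} (hij : i ≠ j)
    (f g : α → ℝ) :
    expect (prodPmf p) (fun x => f (x i) * g (x j)) = expect (p i) f * expect (p j) g := by
  have h := expect_prodPmf_prod p (fun k a => if k = i then f a else if k = j then g a else 1)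
  have h1 : ∀ (F : ι → ℝ) (G : ι → ℝ),
      ∏ k, (if k = i then F k else if k = j then G k else 1) = F i * G j := fun F G => by
    rw [← Finset.mul_prod_erase _ _ (Finset.mem_univ i),
      ← Finset.mul_prod_erase _ _ (Finset.mem_erase.2 ⟨hij.symm, Finset.mem_univ j⟩),
      Finset.prod_eq_one]
    · simp [hij.symm]
    · intro k hk
      simp only [Finset.mem_erase] at hk
      simp [hk.1, hk.2.1]
  simp only [h1] at h
  rw [h, ← h1 (fun k => expect (p k) f) fun k => expect (p k) g]
  refine Finset.prod_congr rfl fun k _ => ?_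
  split_ifs with h2 h3
  · rfl
  · rfl
  · exact expect_const (hp k) 1

end Expectation

/-! ### Typical sequences -/

section Typical

variable {α β ι Z : Type*} [Fintype α] [Fintype β] [Fintype ι] [DecidableEq ι] [Fintype Z]

/-- The cross terms vanish by independence and centring, which leaves one variance per letter. This
is the second moment for Chebyshev's inequality. -/
lemma expect_sum_sq_le {p : ι → α → ℝ} (hp : ∀ i, p i ∈ stdSimplex ℝ α) {g : ι → α → ℝ}
    (h0 : ∀ i, expect (p i) (g i) = 0) (h1 : ∀ i, expect (p i) (fun a => g i a ^ 2) ≤ 1) :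
    expect (prodPmf p) (fun x => (∑ i, g i (x i)) ^ 2) ≤ Fintype.card ι := by
  simp only [sq, Finset.sum_mul_sum, expect_sum]
  calc ∑ i, ∑ j, expect (prodPmf p) (fun x => g i (x i) * g j (x j))
      ≤ ∑ i : ι, ∑ j : ι, (if i = j then 1 else 0) := by
        refine Finset.sum_le_sum fun i _ => Finset.sum_le_sum fun j _ => ?_
        split_ifs with h
        · subst h
          rw [expect_prodPmf_eval hp i (fun a => g i a * g i a)]
          simpa only [sq] using h1 i
        · rw [expect_prodPmf_mul hp h, h0, zero_mul]
    _ = Fintype.card ι := by simp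

lemma mem_typicalSet {Z : Type*} {r : Z → ℝ} {ε : ℝ} {n : ℕ} {z : Fin n → Z} :
    z ∈ typicalSet r ε n ↔ ∀ a, |(∑ i, ind (z i = a)) / n - r a| ≤ ε * r a := by
  simp [typicalSet, ind]

/-- Independent letters whose average law is `ε'`-close to `r` form an `ε`-typical sequence with
high probability. -/
lemma expect_not_typical_le {r : Z → ℝ} (hr : ∀ a, 0 ≤ r a) {ε' ε : ℝ} (hε : ε' < ε) {n : ℕ}
    (hn : 0 < n) {p : Fin n → α → ℝ} (hp : ∀ i, p i ∈ stdSimplex ℝ α) (ψ : Fin n → α → Z)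
    (h : ∀ a, |(∑ i, expect (p i) (fun x => ind (ψ i x = a))) / n - r a| ≤ ε' * r a) :
    expect (prodPmf p) (fun x => ind ((fun i => ψ i (x i)) ∉ typicalSet r ε n)) ≤
      (∑ a, 1 / ((ε - ε') * r a) ^ 2) / n := by
  have hn' : (0 : ℝ) < n := Nat.cast_pos.2 hn
  have hP := prodPmf_mem hp
  have key : ∀ a, expect (prodPmf p)
      (fun x => ind (ε * r a < |(∑ i, ind (ψ i (x i) = a)) / n - r a|)) ≤
        1 / ((ε - ε') * r a) ^ 2 / n := by
    intro a
    set e : Fin n → ℝ := fun i => expect (p i) (fun x => ind (ψ i x = a)) with he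
    -- A null letter must have probability exactly 0, because its term on the right is 1/0 = 0. The
    -- averaged law gives it no mass, so a union bound suffices.
    rcases (hr a).eq_or_lt with h0 | h0
    · have h1 := h a
      simp only [← h0, mul_zero, sub_zero] at h1 ⊢
      have h2 : (∑ i, e i) = 0 := by
        have := abs_nonpos_iff.1 h1
        rcases div_eq_zero_iff.1 this with h3 | h3
        · exact h3
        · exact absurd h3 hn'.ne'
      calc _ ≤ expect (prodPmf p) (fun x => ∑ i, ind (ψ i (x i) = a)) := by
            refine expect_mono hP.1 fun x => ?_
            refine (ind_mono (Q := ∃ i, ψ i (x i) = a) fun hx => ?_).trans (ind_exists_le _)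
            by_contra! hne
            simp [ind_of_not (hne _)] at hx
        _ = 0 := by
            rw [expect_sum]
            simp only [fun i => expect_prodPmf_eval hp i (fun x => ind (ψ i x = a))]
            exact h2
        _ ≤ _ := by simp
    · have hδ : 0 < (ε - ε') * r a := mul_pos (by linarith) h0
      have hsq : expect (prodPmf p) (fun x => (∑ i, (ind (ψ i (x i) = a) - e i)) ^ 2) ≤ n := by
        have := expect_sum_sq_le hp (g := fun i x => ind (ψ i x = a) - e i)
          (fun i => by rw [expect_sub, expect_const (hp i), sub_self]) (fun i => by
            refine expect_le (hp i) fun x => ?_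
            have h1 : 0 ≤ e i := expect_nonneg (hp i).1 fun x => ind_nonneg _
            have h2 : e i ≤ 1 := expect_le (hp i) fun x => ind_le_one _
            have h3 := ind_nonneg (ψ i x = a)
            have h4 := ind_le_one (ψ i x = a)
            rw [sq_le_one_iff_abs_le_one, abs_le]
            constructor <;> linarith)
        simpa using this
      -- The mean frequency is within ε' r(a) of r(a), so a deviation beyond ε r(a) is at least (ε -
      -- ε') r(a) from the mean.
      have hb : ∀ x : Fin n → α, ind (ε * r a < |(∑ i, ind (ψ i (x i) = a)) / n - r a|) ≤
          (∑ i, (ind (ψ i (x i) = a) - e i)) ^ 2 * (1 / (((ε - ε') * r a) * n) ^ 2) := by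
        intro x
        by_cases hx : ε * r a < |(∑ i, ind (ψ i (x i) = a)) / n - r a|
        · rw [ind_of hx, mul_one_div, one_le_div (by positivity), sq_le_sq, abs_of_pos (by positivity),
            ← le_div_iff₀ hn', ← abs_of_pos hn', ← abs_div, Finset.sum_sub_distrib,
            sub_div]
          have h1 := abs_sub_le ((∑ i, ind (ψ i (x i) = a)) / n) ((∑ i, e i) / n) (r a)
          have h2 := h a
          linarith
        · rw [ind_of_not hx]; positivity
      calc _ ≤ _ := expect_mono hP.1 hb
        _ ≤ n * (1 / (((ε - ε') * r a) * n) ^ 2) := by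
            rw [expect_mul_right]; gcongr
        _ = _ := by field_simp
  calc _ ≤ expect (prodPmf p)
        (fun x => ∑ a, ind (ε * r a < |(∑ i, ind (ψ i (x i) = a)) / n - r a|)) := by
        refine expect_mono hP.1 fun x => ?_
        refine (ind_mono fun hx => ?_).trans (ind_exists_le _)
        simpa [mem_typicalSet] using hx
    _ ≤ _ := by
        rw [expect_sum, Finset.sum_div]
        exact Finset.sum_le_sum fun a _ => key a

/-- The deviation allowed at a null letter is ε · 0, so it cannot occur. Hence logarithms of
likelihoods make sense along typical sequences. -/
lemma pos_of_mem_typicalSet {Z : Type*} {r : Z → ℝ} (hr : ∀ a, 0 ≤ r a) {ε : ℝ} {n : ℕ}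
    {z : Fin n → Z} (hz : z ∈ typicalSet r ε n) (i : Fin n) : 0 < r (z i) := by
  refine (hr _).lt_of_ne fun h0 => ?_
  have h := mem_typicalSet.1 hz (z i)
  have hn : (0 : ℝ) < n := Nat.cast_pos.2 i.pos
  rw [← h0, mul_zero, sub_zero, abs_nonpos_iff, div_eq_zero_iff] at h
  have h1 : ind (z i = z i) ≤ ∑ j, ind (z j = z i) :=
    Finset.single_le_sum (f := fun j => ind (z j = z i)) (fun _ _ => ind_nonneg _)
      (Finset.mem_univ i)
  rw [ind_of rfl] at h1
  rcases h with h | h <;> linarith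

/-- The sum is n times the mean of φ under the empirical law, and typicality bounds that law
relative to r letter by letter. For φ ≥ 0 the error is therefore relative. -/
lemma abs_sum_sub_le_of_mem_typicalSet {r : Z → ℝ} {ε : ℝ} {n : ℕ} {z : Fin n → Z}
    (hz : z ∈ typicalSet r ε n) (φ : Z → ℝ) :
    |∑ i, φ (z i) - n * expect r φ| ≤ n * (ε * expect r (fun a => |φ a|)) := by
  rcases Nat.eq_zero_or_pos n with rfl | hn
  · simp
  have hn' : (0 : ℝ) < n := Nat.cast_pos.2 hn
  have h1 : ∑ i, φ (z i) = n * ∑ a, (∑ i, ind (z i = a)) / n * φ a := by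
    rw [Finset.mul_sum]
    have : ∀ i, φ (z i) = ∑ a, ind (z i = a) * φ a := fun i => by
      rw [Finset.sum_eq_single (z i)]
      · rw [ind_of rfl, one_mul]
      · intro a _ ha
        rw [ind_of_not ha.symm, zero_mul]
      · simp
    simp only [this]
    rw [Finset.sum_comm]
    refine Finset.sum_congr rfl fun a _ => ?_
    rw [← Finset.sum_mul]; field_simp
  rw [h1, ← mul_sub, abs_mul, abs_of_pos hn']
  refine mul_le_mul_of_nonneg_left ?_ hn'.le
  simp only [expect]
  rw [← Finset.sum_sub_distrib, Finset.mul_sum]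
  refine (Finset.abs_sum_le_sum_abs _ _).trans (Finset.sum_le_sum fun a _ => ?_)
  rw [← sub_mul, abs_mul, ← mul_assoc]
  exact mul_le_mul_of_nonneg_right (mem_typicalSet.1 hz a) (abs_nonneg _)

/-- On typical sequences the product of a function `g` is within a factor `2 ^ (± n ε K)` of
`2 ^ (-n D)` times the product of `h`. -/
lemma prod_le_and_le_prod_of_mem_typicalSet {r : Z → ℝ} (hr : ∀ a, 0 ≤ r a) {ε : ℝ} {n : ℕ}
    {z : Fin n → Z} (hz : z ∈ typicalSet r ε n) {g h : Z → ℝ} (hg : ∀ a, 0 < r a → 0 < g a)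
    (hh : ∀ a, 0 < r a → 0 < h a) {D K : ℝ}
    (hD : D = expect r (fun a => Real.logb 2 (h a) - Real.logb 2 (g a)))
    (hK : K = expect r (fun a => |Real.logb 2 (h a) - Real.logb 2 (g a)|)) :
    (∏ i, g (z i) ≤ (2 : ℝ) ^ (-(n * (D - ε * K))) * ∏ i, h (z i)) ∧
      (2 : ℝ) ^ (-(n * (D + ε * K))) * ∏ i, h (z i) ≤ ∏ i, g (z i) := by
  set φ : Z → ℝ := fun a => Real.logb 2 (h a) - Real.logb 2 (g a) with hφ
  have hz' := fun i => pos_of_mem_typicalSet hr hz i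
  -- The ratio of the two products is a power of 2 whose exponent is a sum along the sequence, and
  -- typicality pins that sum to its mean.
  have h1 : ∏ i, g (z i) = (2 : ℝ) ^ (-∑ i, φ (z i)) * ∏ i, h (z i) := by
    rw [← Finset.sum_neg_distrib, Real.rpow_sum_of_pos two_pos, ← Finset.prod_mul_distrib]
    refine Finset.prod_congr rfl fun i _ => ?_
    rw [hφ, neg_sub, Real.rpow_sub two_pos, Real.rpow_logb two_pos (by norm_num) (hg _ (hz' i)),
      Real.rpow_logb two_pos (by norm_num) (hh _ (hz' i)),
      div_mul_cancel₀ _ (hh _ (hz' i)).ne']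
  have h2 := abs_le.1 (abs_sum_sub_le_of_mem_typicalSet hz φ)
  have h3 : 0 ≤ ∏ i, h (z i) := Finset.prod_nonneg fun i _ => (hh _ (hz' i)).le
  rw [h1, hD, hK]
  constructor
  · refine mul_le_mul_of_nonneg_right (Real.rpow_le_rpow_of_exponent_le one_le_two ?_) h3
    linarith [h2.1]
  · refine mul_le_mul_of_nonneg_right (Real.rpow_le_rpow_of_exponent_le one_le_two ?_) h3
    linarith [h2.2]

lemma mem_typicalSet_of_injective {Y Z : Type*} {s : Y → ℝ} {r : Z → ℝ} {e : Y → Z}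
    (he : Function.Injective e) (hs : ∀ y, s y = r (e y)) {ε : ℝ} {n : ℕ} {y : Fin n → Y}
    (h : (fun i => e (y i)) ∈ typicalSet r ε n) : y ∈ typicalSet s ε n := by
  rw [mem_typicalSet] at h ⊢
  intro a
  simpa [he.eq_iff, hs] using h (e a)

end Typical

/-! ### Laws and entropies -/

section Law

variable {Ω α β : Type*} [Fintype Ω] [Fintype α] [Fintype β]

lemma law_eq_expect {α : Type*} (p : Ω → ℝ) (f : Ω → α) (a : α) :
    law p f a = expect p (fun ω => ind (f ω = a)) := by
  simp [law, expect, ind]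

lemma law_nonneg {α : Type*} {p : Ω → ℝ} (hp : ∀ ω, 0 ≤ p ω) (f : Ω → α) (a : α) :
    0 ≤ law p f a := by
  rw [law_eq_expect]
  exact expect_nonneg hp fun _ => ind_nonneg _

lemma expect_law (p : Ω → ℝ) (f : Ω → α) (φ : α → ℝ) :
    expect (law p f) φ = expect p (fun ω => φ (f ω)) := by
  classical
  simp only [expect, law, Finset.sum_mul]
  rw [Finset.sum_comm]
  refine Finset.sum_congr rfl fun ω _ => ?_
  rw [Finset.sum_eq_single (f ω)]
  · simp
  · intro a _ ha
    simp [ha.symm]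
  · simp

lemma law_mem {p : Ω → ℝ} (hp : p ∈ stdSimplex ℝ Ω) (f : Ω → α) :
    law p f ∈ stdSimplex ℝ α := by
  refine ⟨law_nonneg hp.1 f, ?_⟩
  have := expect_law p f (fun _ => 1)
  rw [expect_const hp] at this
  simpa [expect] using this

lemma law_pos {α : Type*} {p : Ω → ℝ} (hp : ∀ ω, 0 ≤ p ω) (f : Ω → α) {ω : Ω} (h : 0 < p ω) :
    0 < law p f (f ω) := by
  rw [law_eq_expect]
  refine h.trans_le ?_
  have := Finset.single_le_sum (f := fun ω' => p ω' * ind (f ω' = f ω))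
    (fun ω' _ => mul_nonneg (hp ω') (ind_nonneg _)) (Finset.mem_univ ω)
  rwa [ind_of rfl, mul_one] at this

lemma exists_pos_of_law_pos {α : Type*} {p : Ω → ℝ} (hp : ∀ ω, 0 ≤ p ω) {f : Ω → α} {a : α}
    (h : 0 < law p f a) : ∃ ω, 0 < p ω ∧ f ω = a := by
  classical
  obtain ⟨ω, -, hω⟩ := Finset.exists_ne_zero_of_sum_ne_zero h.ne'
  by_cases hf : f ω = a
  · rw [if_pos hf] at hω
    exact ⟨ω, (hp ω).lt_of_ne hω.symm, hf⟩
  · simp [hf] at hω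

lemma expect_congr_of_pos {p : Ω → ℝ} (hp : ∀ ω, 0 ≤ p ω) {f g : Ω → ℝ}
    (h : ∀ ω, 0 < p ω → f ω = g ω) : expect p f = expect p g := by
  refine Finset.sum_congr rfl fun ω _ => ?_
  rcases (hp ω).eq_or_lt with h0 | h0
  · simp [← h0]
  · rw [h ω h0]

lemma entropy_eq_expect (p : Ω → ℝ) (f : Ω → α) :
    entropy p f = -expect p (fun ω => Real.logb 2 (law p f (f ω))) := by
  rw [← expect_law p f (fun a => Real.logb 2 (law p f a)), entropy, expect, ← Finset.sum_neg_distrib,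
    Finset.sum_div]
  refine Finset.sum_congr rfl fun a _ => ?_
  simp only [Real.negMulLog, Real.logb]
  ring

/-- Entropy depends only on the partition into level sets; this serves to reorder and regroup
tuples. -/
lemma entropy_congr (p : Ω → ℝ) {f : Ω → α} {g : Ω → β}
    (h : ∀ ω ω', f ω' = f ω ↔ g ω' = g ω) : entropy p f = entropy p g := by
  rw [entropy_eq_expect, entropy_eq_expect]
  simp only [law_eq_expect, h]

lemma entropy_eq_of_law {p : Ω → ℝ} {f : Ω → α} {q : α → ℝ} (h : ∀ a, law p f a = q a) :
    expect p (fun ω => Real.logb 2 (q (f ω))) = -entropy p f := by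
  rw [entropy_eq_expect, neg_neg]
  simp [h]

end Law

/-! ### Packing and covering -/

section Packing

variable {Ω A B Z : Type*} [Fintype Ω] [Fintype A] [Fintype B]

/-- The probability that a sequence with independent letters of pmf `Q` is jointly typical with a
given sequence. -/
lemma eventually_expect_typical_le {p : Ω → ℝ} (hp : p ∈ stdSimplex ℝ Ω) (α : Ω → A) (β : Ω → B)
    {Q : A → ℝ} (hQ' : ∀ ω, 0 < p ω → 0 < Q (α ω)) {F : Ω → Z} {ψ : A → B → Z}
    (hψ : ∀ a b a' b', ψ a b = ψ a' b' → a = a' ∧ b = b') (hF : ∀ ω, F ω = ψ (α ω) (β ω)) {D : ℝ}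
    (hD : D = entropy p β - entropy p (fun ω => (α ω, β ω))
      - expect p (fun ω => Real.logb 2 (Q (α ω)))) :
    ∀ᶠ K : ℝ in atTop, ∀ (n : ℕ) (b : Fin n → B) (ε : ℝ), 0 ≤ ε →
      expect (prodPmf fun _ => Q) (fun x => ind ((fun i => ψ (x i) (b i)) ∈ typicalSet (law p F) ε n))
        ≤ (2 : ℝ) ^ (-(n * (D - ε * K))) := by
  set r : A × B → ℝ := law p (fun ω => (α ω, β ω)) with hr
  have hr0 : ∀ z, 0 ≤ r z := law_nonneg hp.1 _
  -- Change of measure: on typical pairs the product of Q is at most 2^(-n(D - εK)) times the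
  -- product of h, the conditional pmf of α given β. For every b the latter sums to at most 1 over
  -- x, so nothing is asked of b itself.
  set g : A × B → ℝ := fun z => Q z.1
  set h : A × B → ℝ := fun z => r z / law p β z.2
  have hrB : ∀ b, ∑ a, r (a, b) = law p β b := fun b => by
    simp only [hr, law_eq_expect, Prod.mk.injEq, ind_and]
    rw [← expect_sum]
    congr 1; funext ω
    rw [← Finset.sum_mul, Finset.sum_eq_single (α ω), ind_of rfl, one_mul]
    · intro a _ ha
      exact ind_of_not ha.symm
    · simp
  have hrpos : ∀ z, 0 < r z → ∃ ω, 0 < p ω ∧ (α ω, β ω) = z := fun z hz =>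
    exists_pos_of_law_pos hp.1 hz
  have hg : ∀ z, 0 < r z → 0 < g z := by
    intro z hz
    obtain ⟨ω, hω, rfl⟩ := hrpos z hz
    exact hQ' ω hω
  have hB : ∀ z, 0 < r z → 0 < law p β z.2 := by
    intro z hz
    obtain ⟨ω, hω, rfl⟩ := hrpos z hz
    exact law_pos hp.1 β hω
  have hh : ∀ z, 0 < r z → 0 < h z := fun z hz => div_pos hz (hB z hz)
  have hD' : D = expect r (fun z => Real.logb 2 (h z) - Real.logb 2 (g z)) := by
    rw [hr, expect_law, hD, entropy_eq_expect, entropy_eq_expect, sub_neg_eq_add, neg_add_eq_sub,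
      ← expect_sub, ← expect_sub]
    refine expect_congr_of_pos hp.1 fun ω hω => ?_
    have h1 : 0 < r (α ω, β ω) := law_pos hp.1 (fun ω => (α ω, β ω)) hω
    simp only [h, g]
    rw [Real.logb_div h1.ne' (hB _ h1).ne']
  -- Only a lower bound on K matters. Asking for all large K lets several estimates share one
  -- constant, independent of ε and n.
  filter_upwards [eventually_ge_atTop (expect r fun z => |Real.logb 2 (h z) - Real.logb 2 (g z)|)]
    with K hK n b ε hε
  have key : ∀ x : Fin n → A,
      prodPmf (fun _ => Q) x * ind ((fun i => ψ (x i) (b i)) ∈ typicalSet (law p F) ε n) ≤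
        (2 : ℝ) ^ (-(n * (D - ε * K))) * ∏ i, h (x i, b i) := by
    intro x
    have hh0 : 0 ≤ ∏ i, h (x i, b i) :=
      Finset.prod_nonneg fun i _ => div_nonneg (hr0 _) (law_nonneg hp.1 _ _)
    by_cases hx : (fun i => ψ (x i) (b i)) ∈ typicalSet (law p F) ε n
    · rw [ind_of hx, mul_one]
      have hx' : (fun i => (x i, b i)) ∈ typicalSet r ε n := by
        refine mem_typicalSet_of_injective (e := fun z : A × B => ψ z.1 z.2) ?_ ?_ hx
        · intro z z' hz
          exact Prod.ext_iff.2 (hψ _ _ _ _ hz)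
        · intro z
          rw [hr, law_eq_expect, law_eq_expect]
          congr 1; funext ω
          congr 1
          rw [hF]
          exact propext ⟨fun h => by rw [← h], fun h => Prod.ext_iff.2 (hψ _ _ _ _ h)⟩
      refine (prod_le_and_le_prod_of_mem_typicalSet hr0 hx' hg hh hD' rfl).1.trans ?_
      refine mul_le_mul_of_nonneg_right (Real.rpow_le_rpow_of_exponent_le one_le_two ?_) hh0
      gcongr
    · rw [ind_of_not hx, mul_zero]
      exact mul_nonneg (by positivity) hh0
  calc _ ≤ ∑ x : Fin n → A, (2 : ℝ) ^ (-(n * (D - ε * K))) * ∏ i, h (x i, b i) :=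
        Finset.sum_le_sum fun x _ => key x
    _ = (2 : ℝ) ^ (-(n * (D - ε * K))) * ∏ i, ∑ a, h (a, b i) := by
        rw [← Finset.mul_sum, Fintype.prod_sum]
    _ ≤ (2 : ℝ) ^ (-(n * (D - ε * K))) * 1 := by
        gcongr
        refine Finset.prod_le_one (fun i _ => Finset.sum_nonneg fun a _ =>
          div_nonneg (hr0 _) (law_nonneg hp.1 _ _)) fun i _ => ?_
        simp only [h]
        rw [← Finset.sum_div, hrB]
        exact div_self_le_one _
    _ = _ := mul_one _

/-- Convexity of the M-th power at 1 - xy = (1 - x)·1 + x(1 - y), then 1 - y ≤ exp(-y). In covering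
it separates atypicality of the source (1 - x) from failure of the codebook. -/
lemma one_sub_mul_pow_le {x y : ℝ} (hx0 : 0 ≤ x) (hx1 : x ≤ 1) (hy : y ≤ 1) (M : ℕ) :
    (1 - x * y) ^ M ≤ 1 - x + Real.exp (-(M * y)) := by
  have h := (convexOn_pow (𝕜 := ℝ) M).2 (x := 1) (y := 1 - y) (by simp) (by simpa using hy)
    (sub_nonneg.2 hx1) hx0 (by ring)
  simp only [smul_eq_mul, one_pow, mul_one] at h
  have h1 : (1 - y) ^ M ≤ Real.exp (-(M * y)) := by
    rw [← mul_neg, Real.exp_nat_mul]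
    exact pow_le_pow_left₀ (by linarith) (Real.one_sub_le_exp_neg y) M
  calc (1 - x * y) ^ M = (1 - x + x * (1 - y)) ^ M := by ring
    _ ≤ 1 - x + x * (1 - y) ^ M := h
    _ ≤ 1 - x + (1 - y) ^ M := by
        gcongr
        exact mul_le_of_le_one_left (pow_nonneg (by linarith) _) hx1
    _ ≤ _ := by gcongr

/-- Relative entropies are nonnegative. -/
lemma expect_logb_sub_nonneg {P : A → ℝ} (hP : P ∈ stdSimplex ℝ A) {k : A → B → ℝ}
    (hk : ∀ a, k a ∈ stdSimplex ℝ B) {Q : B → ℝ} (hQ : Q ∈ stdSimplex ℝ B)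
    (hQ' : ∀ z, 0 < joinPmf P k z → 0 < Q z.2) :
    0 ≤ expect (joinPmf P k) (fun z => Real.logb 2 (k z.1 z.2) - Real.logb 2 (Q z.2)) := by
  have hr := joinPmf_mem hP hk
  have hkpos : ∀ z, 0 < joinPmf P k z → 0 < k z.1 z.2 := fun z hz =>
    pos_of_mul_pos_right hz (hP.1 _)
  set D := expect (joinPmf P k) (fun z => Real.logb 2 (k z.1 z.2) - Real.logb 2 (Q z.2)) with hD
  -- Gibbs' inequality: log t ≤ t - 1 is applied termwise with t = Q/k, and the resulting masses
  -- cancel.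
  have h1 : -(D * Real.log 2) ≤ 0 := by
    calc -(D * Real.log 2)
        = expect (joinPmf P k) (fun z => Real.log (Q z.2 / k z.1 z.2)) := by
          rw [hD, ← neg_mul, ← neg_one_mul, ← expect_mul_left, ← expect_mul_right]
          refine expect_congr_of_pos hr.1 fun z hz => ?_
          rw [Real.log_div (hQ' z hz).ne' (hkpos z hz).ne', Real.logb, Real.logb]
          have : Real.log 2 ≠ 0 := (Real.log_pos one_lt_two).ne'
          field_simp
          ring
      _ ≤ ∑ z : A × B, (P z.1 * Q z.2 - joinPmf P k z) := by
          refine Finset.sum_le_sum fun z _ => ?_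
          rcases (hr.1 z).eq_or_lt with h0 | h0
          · rw [← h0, zero_mul, sub_zero]
            exact mul_nonneg (hP.1 _) (hQ.1 _)
          · have h2 := Real.log_le_sub_one_of_pos (div_pos (hQ' z h0) (hkpos z h0))
            refine (mul_le_mul_of_nonneg_left h2 h0.le).trans_eq ?_
            have := (hkpos z h0).ne'
            simp only [joinPmf]
            field_simp
      _ = 0 := by
          rw [Finset.sum_sub_distrib, hr.2, Fintype.sum_prod_type]
          simp [← Finset.mul_sum, hQ.2, hP.2]
  nlinarith [Real.log_pos one_lt_two]

/-- The probability that none of `M` independent codewords with letters of pmf `Q` is jointly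
typical with a random sequence. -/
lemma eventually_expect_covering_le {P : A → ℝ} (hP : P ∈ stdSimplex ℝ A) {k : A → B → ℝ}
    (hk : ∀ a, k a ∈ stdSimplex ℝ B) {Q : B → ℝ} (hQ : Q ∈ stdSimplex ℝ B)
    (hQ' : ∀ z, 0 < joinPmf P k z → 0 < Q z.2) {D : ℝ}
    (hD : D = expect (joinPmf P k) (fun z => Real.logb 2 (k z.1 z.2) - Real.logb 2 (Q z.2))) :
    ∀ᶠ K : ℝ in atTop, ∀ (n M : ℕ) (ε : ℝ), 0 < n → 0 < ε →
      expect (prodPmf fun _ : Fin n => P) (fun y => (1 - expect (prodPmf fun _ : Fin n => Q)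
        (fun q => ind ((fun i => (y i, q i)) ∈ typicalSet (joinPmf P k) ε n))) ^ M) ≤
        (∑ z, 1 / (ε * joinPmf P k z) ^ 2) / n
          + Real.exp (-(M * (2 : ℝ) ^ (-(n * (D + ε * K))))) := by
  have hr := joinPmf_mem hP hk
  have hkpos : ∀ z, 0 < joinPmf P k z → 0 < k z.1 z.2 := fun z hz =>
    pos_of_mul_pos_right hz (hP.1 _)
  have hD0 : 0 ≤ D := hD ▸ expect_logb_sub_nonneg hP hk hQ hQ'
  filter_upwards [eventually_ge_atTop (0 : ℝ), eventually_ge_atTop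
    (expect (joinPmf P k) fun z => |Real.logb 2 (k z.1 z.2) - Real.logb 2 (Q z.2)|)]
    with K hK0 hK n M ε hn hε
  set T : (Fin n → A) → (Fin n → B) → Prop :=
    fun y q => (fun i => (y i, q i)) ∈ typicalSet (joinPmf P k) ε n with hT
  -- The chance that the kernel k itself would produce a typical companion of y. The change of
  -- measure in `hs` turns it into a lower bound for a codeword drawn from Q.
  set t : (Fin n → A) → ℝ := fun y => expect (prodPmf fun i => k (y i)) (fun q => ind (T y q)) with ht
  have hkn := fun y : Fin n → A => prodPmf_mem fun i => hk (y i)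
  have hs : ∀ y, t y * (2 : ℝ) ^ (-(n * (D + ε * K))) ≤
      expect (prodPmf fun _ : Fin n => Q) (fun q => ind (T y q)) := by
    intro y
    rw [ht, ← expect_mul_right]
    refine Finset.sum_le_sum fun q _ => ?_
    beta_reduce
    by_cases hq : T y q
    · rw [ind_of hq, mul_one, one_mul, mul_comm]
      refine le_trans ?_ (prod_le_and_le_prod_of_mem_typicalSet hr.1 hq (g := fun z => Q z.2)
        (h := fun z => k z.1 z.2) hQ' hkpos hD rfl).2
      refine mul_le_mul_of_nonneg_right (Real.rpow_le_rpow_of_exponent_le one_le_two ?_)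
        ((hkn y).1 q)
      gcongr
    · simp [ind_of_not hq]
  have hPn := prodPmf_mem fun _ : Fin n => hP
  have h1 : ∀ y, (1 - expect (prodPmf fun _ : Fin n => Q) (fun q => ind (T y q))) ^ M ≤
      (1 - t y) + Real.exp (-(M * (2 : ℝ) ^ (-(n * (D + ε * K))))) := by
    intro y
    refine (pow_le_pow_left₀ ?_ (sub_le_sub_left (hs y) 1) M).trans
      (one_sub_mul_pow_le ?_ ?_ ?_ M)
    · exact sub_nonneg.2 (expect_le (prodPmf_mem fun _ => hQ) fun _ => ind_le_one _)
    · exact expect_nonneg (hkn y).1 fun _ => ind_nonneg _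
    · exact expect_le (hkn y) fun _ => ind_le_one _
    -- This is where D ≥ 0 enters.
    · refine Real.rpow_le_one_of_one_le_of_nonpos one_le_two ?_
      have : 0 ≤ (n : ℝ) * (D + ε * K) := by positivity
      linarith
  refine (expect_mono hPn.1 h1).trans ?_
  rw [expect_add, expect_const hPn]
  gcongr
  have h2 : ∀ y, 1 - t y = expect (prodPmf fun i => k (y i)) (fun q => ind (¬T y q)) := by
    intro y
    simp only [ind_not]
    rw [expect_sub, expect_const (hkn y)]
  simp only [h2]
  rw [← expect_prodPmf_joinPmf (fun _ : Fin n => P) (fun _ => k) (fun y q => ind (¬T y q))]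
  have := expect_not_typical_le (r := joinPmf P k) hr.1 hε hn (fun _ => hr) (fun _ z => z) (by
    intro z
    have : expect (joinPmf P k) (fun x => ind (x = z)) = joinPmf P k z := by
      rw [expect, Finset.sum_eq_single z]
      · rw [ind_of rfl, mul_one]
      · intro x _ hx
        rw [ind_of_not hx, mul_zero]
      · simp
    simp only [this]
    have hn' : (n : ℝ) ≠ 0 := by positivity
    simp [hn'])
  simpa using this

end Packing

/-! ### Random coding -/

section RandomCoding

/-- Union bound for a two-stage experiment whose second stage depends on an index `u t₁` determined
by the first one; a failure is caused by `F₀`, `F₁`, `F₂` or by a competitor `w'` which passes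
the tests `G₁`, `G₂` of both stages for a common index. -/
lemma expect_failure_le {T₁ T₂ U W : Type*} [Fintype T₁] [Fintype T₂] [Fintype U] [Fintype W]
    {μ₁ : T₁ → ℝ} (hμ₁ : μ₁ ∈ stdSimplex ℝ T₁) {μ₂ : U → T₂ → ℝ}
    (hμ₂ : ∀ u, μ₂ u ∈ stdSimplex ℝ T₂) (u : T₁ → U) {err : T₁ → T₂ → Prop} {F₀ F₁ : T₁ → Prop}
    {F₂ : U → T₂ → Prop} {G₁ : W → U → T₁ → Prop} {G₂ : W → U → T₂ → Prop} {w : W}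
    (herr : ∀ t₁ t₂, err t₁ t₂ → F₀ t₁ ∨ F₁ t₁ ∨ F₂ (u t₁) t₂ ∨
      ∃ w', w' ≠ w ∧ ∃ v, G₁ w' v t₁ ∧ G₂ w' v t₂)
    {e₀ e₁ e₂ : ℝ} (h₀ : expect μ₁ (fun t => ind (F₀ t)) ≤ e₀)
    (h₁ : expect μ₁ (fun t => ind (F₁ t)) ≤ e₁)
    (h₂ : ∀ v, expect (μ₂ v) (fun t => ind (F₂ v t)) ≤ e₂) {b : W → ℝ} (hb : ∀ w', 0 ≤ b w')
    (hG : ∀ w', w' ≠ w → ∃ a₁ a₂ b₁ b₂ : ℝ, 0 ≤ a₂ ∧ 0 ≤ b₂ ∧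
      expect μ₁ (fun t => ind (G₁ w' (u t) t)) ≤ a₁ ∧
      (∀ v, expect (μ₂ v) (fun t => ind (G₂ w' v t)) ≤ a₂) ∧
      (∀ v, expect μ₁ (fun t => ind (G₁ w' v t)) ≤ b₁) ∧
      (∀ v v', v' ≠ v → expect (μ₂ v) (fun t => ind (G₂ w' v' t)) ≤ b₂) ∧
      a₁ * a₂ + Fintype.card U * (b₁ * b₂) ≤ b w') :
    expect μ₁ (fun t₁ => expect (μ₂ (u t₁)) (fun t₂ => ind (err t₁ t₂))) ≤
      e₀ + e₁ + e₂ + ∑ w', b w' := by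
  classical
  -- The second-stage bound is uniform in t₁, so the two bounds multiply although the second stage
  -- depends on the first through the index.
  have hprod : ∀ (X : T₁ → Prop) (Y : T₁ → T₂ → Prop) (x y : ℝ), 0 ≤ y →
      expect μ₁ (fun t => ind (X t)) ≤ x →
      (∀ t₁, expect (μ₂ (u t₁)) (fun t₂ => ind (Y t₁ t₂)) ≤ y) →
      expect μ₁ (fun t₁ => expect (μ₂ (u t₁)) (fun t₂ => ind (X t₁ ∧ Y t₁ t₂))) ≤ x * y := by
    intro X Y x y hy hX hY
    simp only [ind_and, expect_mul_left]
    calc _ ≤ expect μ₁ (fun t => ind (X t) * y) :=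
          expect_mono hμ₁.1 fun t => mul_le_mul_of_nonneg_left (hY t) (ind_nonneg _)
      _ ≤ x * y := by
          rw [expect_mul_right]
          exact mul_le_mul_of_nonneg_right hX hy
  -- The union over v is split at the relay's index. The condition v ≠ u t₁ is attached to the
  -- second-stage event, so G₁ is estimated at a fixed v without conditioning on the selection.
  have hpt : ∀ t₁ t₂, ind (err t₁ t₂) ≤ ind (F₀ t₁) + ind (F₁ t₁) + ind (F₂ (u t₁) t₂) +
      ∑ w', ((if w' ≠ w then ind (G₁ w' (u t₁) t₁ ∧ G₂ w' (u t₁) t₂) else 0) +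
        ∑ v, if w' ≠ w then ind (G₁ w' v t₁ ∧ (v ≠ u t₁ ∧ G₂ w' v t₂)) else 0) := by
    intro t₁ t₂
    have hS : ind (∃ w', w' ≠ w ∧ ∃ v, G₁ w' v t₁ ∧ G₂ w' v t₂) ≤
        ∑ w', ((if w' ≠ w then ind (G₁ w' (u t₁) t₁ ∧ G₂ w' (u t₁) t₂) else 0) +
        ∑ v, if w' ≠ w then ind (G₁ w' v t₁ ∧ (v ≠ u t₁ ∧ G₂ w' v t₂)) else 0) := by
      refine (ind_exists_le _).trans (Finset.sum_le_sum fun w' _ => ?_)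
      by_cases hw : w' = w
      · simp [hw, ind]
      · simp only [ne_eq, hw, not_false_eq_true, true_and, if_true]
        refine le_trans (ind_mono (Q := (G₁ w' (u t₁) t₁ ∧ G₂ w' (u t₁) t₂) ∨
          ∃ v, G₁ w' v t₁ ∧ (v ≠ u t₁ ∧ G₂ w' v t₂)) ?_)
          ((ind_or_le _ _).trans (add_le_add_right (ind_exists_le _) _))
        rintro ⟨v, hv1, hv2⟩
        by_cases hvu : v = u t₁
        · subst hvu; exact Or.inl ⟨hv1, hv2⟩
        · exact Or.inr ⟨v, hv1, hvu, hv2⟩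
    have h1 := ind_mono (herr t₁ t₂)
    have h2 := ind_or_le (F₀ t₁) (F₁ t₁ ∨ F₂ (u t₁) t₂ ∨
      ∃ w', w' ≠ w ∧ ∃ v, G₁ w' v t₁ ∧ G₂ w' v t₂)
    have h3 := ind_or_le (F₁ t₁) (F₂ (u t₁) t₂ ∨
      ∃ w', w' ≠ w ∧ ∃ v, G₁ w' v t₁ ∧ G₂ w' v t₂)
    have h4 := ind_or_le (F₂ (u t₁) t₂) (∃ w', w' ≠ w ∧ ∃ v, G₁ w' v t₁ ∧ G₂ w' v t₂)
    linarith
  refine (expect_mono hμ₁.1 fun t₁ => expect_mono (hμ₂ (u t₁)).1 fun t₂ => hpt t₁ t₂).trans ?_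
  simp only [expect_add, expect_sum, expect_const (hμ₂ _)]
  refine add_le_add (add_le_add (add_le_add h₀ h₁) (expect_le hμ₁ fun t => h₂ _))
    (Finset.sum_le_sum fun w' _ => ?_)
  by_cases hw : w' = w
  · simp only [ne_eq, hw, not_true_eq_false, if_false]
    simpa [expect] using hb w
  · simp only [ne_eq, hw, not_false_eq_true, if_true]
    obtain ⟨a₁, a₂, b₁, b₂, ha₂, hb₂, h1, h2, h3, h4, h5⟩ := hG w' hw
    refine le_trans (add_le_add (hprod _ _ a₁ a₂ ha₂ h1 fun t => h2 _)
      (Finset.sum_le_sum fun v _ => hprod _ _ b₁ b₂ hb₂ (h3 v) fun t => ?_)) ?_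
    · by_cases hv : v = u t
      · simpa [hv, ind, expect] using hb₂
      · simpa [hv] using h4 (u t) v hv
    · simpa using h5

/-! ### Competing messages within one slot -/

section Slots

variable {Ω S B Y Q U YR V : Type*} [Fintype Ω] [Fintype S] [Fintype B] [Fintype Y] [Fintype Q]
  [Fintype U] [DecidableEq U] [Fintype YR] [Fintype V]
  {P : Ω → ℝ} {PS : S → ℝ} {κ : B → ℝ} {c c' : Ω → S} {τ : S → B → S}

/-- In `hc`, s is the sent codeword pair, b the fresh part of the competitor and τ s b its codeword
pair; the kinds of competitor are choices of τ and κ. Channel output and selection do not involve b,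
so b can be averaged first. -/
lemma expect_first_slot_le_same (hPS : PS ∈ stdSimplex ℝ S)
    (hc : ∀ f : S → S → ℝ, expect P (fun ω => f (c ω) (c' ω)) =
      expect PS (fun s => expect κ (fun b => f s (τ s b))))
    {W : S → YR × Y → ℝ} (hW : ∀ s, W s ∈ stdSimplex ℝ (YR × Y))
    {PQ : Q → ℝ} (hPQ : PQ ∈ stdSimplex ℝ Q) (sel : (U → Q) → YR → U) {T : S → Y → Q → Prop} {a : ℝ}
    (h : ∀ s y q, expect κ (fun b => ind (T (τ s b) y q)) ≤ a) :
    expect P (fun ω => expect (prodPmf fun _ : U => PQ) (fun cq =>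
      expect (W (c ω)) (fun y => ind (T (c' ω) y.2 (cq (sel cq y.1)))))) ≤ a := by
  rw [hc fun s s' => expect (prodPmf fun _ : U => PQ) (fun cq =>
      expect (W s) (fun y => ind (T s' y.2 (cq (sel cq y.1)))))]
  exact expect_le hPS fun s => expect_swap_le (prodPmf_mem fun _ => hPQ) fun cq =>
    expect_swap_le (hW s) fun y => h _ _ _

lemma expect_first_slot_le_diff (hPS : PS ∈ stdSimplex ℝ S)
    (hc : ∀ f : S → S → ℝ, expect P (fun ω => f (c ω) (c' ω)) =
      expect PS (fun s => expect κ (fun b => f s (τ s b))))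
    {W : S → YR × Y → ℝ} (hW : ∀ s, W s ∈ stdSimplex ℝ (YR × Y))
    {PQ : Q → ℝ} (hPQ : PQ ∈ stdSimplex ℝ Q) (v : U) {T : S → Y → Q → Prop} {a : ℝ}
    (h : ∀ s y, expect PQ (fun q => expect κ (fun b => ind (T (τ s b) y q))) ≤ a) :
    expect P (fun ω => expect (prodPmf fun _ : U => PQ) (fun cq =>
      expect (W (c ω)) (fun y => ind (T (c' ω) y.2 (cq v))))) ≤ a := by
  rw [hc fun s s' => expect (prodPmf fun _ : U => PQ) (fun cq =>
      expect (W s) (fun y => ind (T s' y.2 (cq v))))]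
  refine expect_le hPS fun s => ?_
  have h1 : ∀ b, expect (prodPmf fun _ : U => PQ) (fun cq =>
      expect (W s) (fun y => ind (T (τ s b) y.2 (cq v)))) =
      expect (W s) (fun y => expect PQ (fun q => ind (T (τ s b) y.2 q))) := fun b => by
    rw [expect_comm]
    congr 1; funext y
    exact expect_prodPmf_eval (fun _ => hPQ) v fun q => ind (T (τ s b) y.2 q)
  simp only [h1]
  refine expect_swap_le (hW s) fun y => ?_
  rw [expect_comm]
  exact h s y.2

lemma expect_second_slot_le_same (hPS : PS ∈ stdSimplex ℝ S)
    (hc : ∀ f : S → S → ℝ, expect P (fun ω => f (c ω) (c' ω)) =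
      expect PS (fun s => expect κ (fun b => f s (τ s b))))
    {W : S → V → Y → ℝ} (hW : ∀ s v, W s v ∈ stdSimplex ℝ Y)
    {PV : V → ℝ} (hPV : PV ∈ stdSimplex ℝ V) (v : U) {T : S → V → Y → Prop} {a : ℝ}
    (h : ∀ s x y, expect κ (fun b => ind (T (τ s b) x y)) ≤ a) :
    expect P (fun ω => expect (prodPmf fun _ : U => PV) (fun cR =>
      expect (W (c ω) (cR v)) (fun y => ind (T (c' ω) (cR v) y)))) ≤ a := by
  rw [hc fun s s' => expect (prodPmf fun _ : U => PV) (fun cR =>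
      expect (W s (cR v)) (fun y => ind (T s' (cR v) y)))]
  exact expect_le hPS fun s => expect_swap_le (prodPmf_mem fun _ => hPV) fun cR =>
    expect_swap_le (hW s _) fun y => h _ _ _

/-- The output depends on the relay codebook only through its entry at v, so the entry at v' ≠ v is
fresh. -/
lemma expect_second_slot_le_diff (hPS : PS ∈ stdSimplex ℝ S)
    (hc : ∀ f : S → S → ℝ, expect P (fun ω => f (c ω) (c' ω)) =
      expect PS (fun s => expect κ (fun b => f s (τ s b))))
    {W : S → V → Y → ℝ} (hW : ∀ s v, W s v ∈ stdSimplex ℝ Y)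
    {PV : V → ℝ} (hPV : PV ∈ stdSimplex ℝ V) {v v' : U} (hv : v' ≠ v) {T : S → V → Y → Prop} {a : ℝ}
    (h : ∀ s y, expect PV (fun x => expect κ (fun b => ind (T (τ s b) x y))) ≤ a) :
    expect P (fun ω => expect (prodPmf fun _ : U => PV) (fun cR =>
      expect (W (c ω) (cR v)) (fun y => ind (T (c' ω) (cR v') y)))) ≤ a := by
  simp only [fun ω => expect_prodPmf_eval₂ hPV hv fun x x' =>
    expect (W (c ω) x) (fun y => ind (T (c' ω) x' y))]
  rw [hc fun s s' => expect PV (fun x => expect PV (fun x' =>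
      expect (W s x) (fun y => ind (T s' x' y))))]
  refine expect_le hPS fun s => expect_swap_le hPV fun x => ?_
  simp only [fun b => expect_comm PV (W s x) fun x' y => ind (T (τ s b) x' y)]
  refine expect_swap_le (hW s x) fun y => ?_
  rw [expect_comm]
  exact h s y

end Slots

/-! ### Joint law of the codewords of two message pairs -/

section Codebooks

variable {A A' I J : Type*} [Fintype A] [Fintype A'] [Fintype I] [Fintype J] [DecidableEq I]
  [DecidableEq J]

/-- The law of two independent codebooks with independent codewords. -/
def codebooks (I J : Type*) [Fintype I] [Fintype J] (P : A → ℝ) (P' : A' → ℝ) :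
    (I → A) × (J → A') → ℝ :=
  joinPmf (prodPmf fun _ => P) (fun _ => prodPmf fun _ => P')

variable {P : A → ℝ} {P' : A' → ℝ}

lemma codebooks_mem (hP : P ∈ stdSimplex ℝ A) (hP' : P' ∈ stdSimplex ℝ A') :
    codebooks I J P P' ∈ stdSimplex ℝ ((I → A) × (J → A')) :=
  joinPmf_mem (prodPmf_mem fun _ => hP) fun _ => prodPmf_mem fun _ => hP'

lemma expect_codebooks (hP : P ∈ stdSimplex ℝ A) (hP' : P' ∈ stdSimplex ℝ A') (w : I × J)
    (f : A × A' → ℝ) :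
    expect (codebooks I J P P') (fun ω => f (ω.1 w.1, ω.2 w.2)) =
      expect (joinPmf P fun _ => P') f := by
  rw [codebooks, expect_joinPmf, expect_joinPmf]
  simp only [fun c : I → A => expect_prodPmf_eval (fun _ => hP') w.2 fun a' => f (c w.1, a')]
  exact expect_prodPmf_eval (fun _ => hP) w.1 fun a => expect P' fun a' => f (a, a')

/-- Provides `hc` when only the first message differs: the first codeword is fresh and the second is
shared. The next two lemmas treat the other kinds. -/
lemma expect_codebooks_fst (hP : P ∈ stdSimplex ℝ A) (hP' : P' ∈ stdSimplex ℝ A') {w w' : I × J}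
    (h₁ : w'.1 ≠ w.1) (h₂ : w'.2 = w.2) (f : A × A' → A × A' → ℝ) :
    expect (codebooks I J P P') (fun ω => f (ω.1 w.1, ω.2 w.2) (ω.1 w'.1, ω.2 w'.2)) =
      expect (joinPmf P fun _ => P') (fun s => expect P fun b => f s (b, s.2)) := by
  rw [codebooks, expect_joinPmf, expect_joinPmf, h₂]
  simp only [fun c : I → A => expect_prodPmf_eval (fun _ => hP') w.2 fun a' =>
    f (c w.1, a') (c w'.1, a')]
  rw [expect_prodPmf_eval₂ hP h₁ fun a b => expect P' fun a' => f (a, a') (b, a')]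
  congr 1; funext a
  exact expect_comm _ _ _

lemma expect_codebooks_snd (hP : P ∈ stdSimplex ℝ A) (hP' : P' ∈ stdSimplex ℝ A') {w w' : I × J}
    (h₁ : w'.1 = w.1) (h₂ : w'.2 ≠ w.2) (f : A × A' → A × A' → ℝ) :
    expect (codebooks I J P P') (fun ω => f (ω.1 w.1, ω.2 w.2) (ω.1 w'.1, ω.2 w'.2)) =
      expect (joinPmf P fun _ => P') (fun s => expect P' fun b => f s (s.1, b)) := by
  rw [codebooks, expect_joinPmf, expect_joinPmf, h₁]
  simp only [fun c : I → A => expect_prodPmf_eval₂ hP' h₂ fun a' b' =>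
    f (c w.1, a') (c w.1, b')]
  exact expect_prodPmf_eval (fun _ => hP) w.1 fun a => expect P' fun a' => expect P' fun b' =>
    f (a, a') (a, b')

lemma expect_codebooks_both (hP : P ∈ stdSimplex ℝ A) (hP' : P' ∈ stdSimplex ℝ A') {w w' : I × J}
    (h₁ : w'.1 ≠ w.1) (h₂ : w'.2 ≠ w.2) (f : A × A' → A × A' → ℝ) :
    expect (codebooks I J P P') (fun ω => f (ω.1 w.1, ω.2 w.2) (ω.1 w'.1, ω.2 w'.2)) =
      expect (joinPmf P fun _ => P') (fun s => expect (joinPmf P fun _ => P') fun b => f s b) := by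
  simp only [codebooks, expect_joinPmf]
  simp only [fun c : I → A => expect_prodPmf_eval₂ hP' h₂ fun a' b' =>
    f (c w.1, a') (c w'.1, b')]
  rw [expect_prodPmf_eval₂ hP h₁ fun a b => expect P' fun a' => expect P' fun b' =>
    f (a, a') (b, b')]
  congr 1; funext a
  exact expect_comm _ _ _

end Codebooks

end RandomCoding

/-! ### The random GQF code -/

/-- Bounds on the probabilities that independent codewords `x`, `x'` pass a test together with
given sequences, when the first one, the second one or both are fresh; the codeword from the
auxiliary codebook with pmf `PQ` is given (bounds `a`) or fresh (bounds `b`). -/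
structure PackingBound {A A' Y Q : Type*} [Fintype A] [Fintype A'] [Fintype Q] (P : A → ℝ)
    (P' : A' → ℝ) (PQ : Q → ℝ) (T : A × A' → Y → Q → Prop) (a b : Fin 3 → ℝ) : Prop where
  fst_same : ∀ x' y q, expect P (fun x => ind (T (x, x') y q)) ≤ a 0
  snd_same : ∀ x y q, expect P' (fun x' => ind (T (x, x') y q)) ≤ a 1
  both_same : ∀ y q, expect (joinPmf P fun _ => P') (fun x => ind (T x y q)) ≤ a 2
  fst_diff : ∀ x' y, expect PQ (fun q => expect P (fun x => ind (T (x, x') y q))) ≤ b 0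
  snd_diff : ∀ x y, expect PQ (fun q => expect P' (fun x' => ind (T (x, x') y q))) ≤ b 1
  both_diff : ∀ y, expect PQ (fun q => expect (joinPmf P fun _ => P')
    (fun x => ind (T x y q))) ≤ b 2

/-! ### Competitors sorted by the messages in which they differ -/

section PackingBound

variable {A A' Y Q V I J U YR : Type*} [Fintype A] [Fintype A'] [Fintype Y] [Fintype Q] [Fintype V]
  [Fintype I] [Fintype J] [DecidableEq I] [DecidableEq J] [Fintype U] [DecidableEq U] [Fintype YR]
  {P : A → ℝ} {P' : A' → ℝ} {PQ : Q → ℝ} {T : A × A' → Y → Q → Prop} {a b : Fin 3 → ℝ}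

/-- The kind of a competitor `w'` of the message pair `w`: only its first message, only its second
message or both differ. -/
def kind (w w' : I × J) : Fin 3 := if w'.2 = w.2 then 0 else if w'.1 = w.1 then 1 else 2

lemma PackingBound.first_slot_le (h : PackingBound P P' PQ T a b) (hP : P ∈ stdSimplex ℝ A)
    (hP' : P' ∈ stdSimplex ℝ A') (hPQ : PQ ∈ stdSimplex ℝ Q) {W : A × A' → YR × Y → ℝ}
    (hW : ∀ s, W s ∈ stdSimplex ℝ (YR × Y)) (sel : (U → Q) → YR → U) {w w' : I × J} (hw : w' ≠ w) :
    (expect (codebooks I J P P') (fun ω => expect (prodPmf fun _ : U => PQ) (fun cq =>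
      expect (W (ω.1 w.1, ω.2 w.2)) (fun y =>
        ind (T (ω.1 w'.1, ω.2 w'.2) y.2 (cq (sel cq y.1)))))) ≤ a (kind w w')) ∧
    ∀ v, expect (codebooks I J P P') (fun ω => expect (prodPmf fun _ : U => PQ) (fun cq =>
      expect (W (ω.1 w.1, ω.2 w.2)) (fun y =>
        ind (T (ω.1 w'.1, ω.2 w'.2) y.2 (cq v))))) ≤ b (kind w w') := by
  have hS : joinPmf P (fun _ => P') ∈ stdSimplex ℝ (A × A') := joinPmf_mem hP fun _ => hP'
  unfold kind
  by_cases h2 : w'.2 = w.2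
  · have h1 : w'.1 ≠ w.1 := fun h1 => hw (Prod.ext h1 h2)
    simp only [if_pos h2]
    exact ⟨expect_first_slot_le_same hS (expect_codebooks_fst hP hP' h1 h2) hW hPQ sel
        fun s y q => h.fst_same s.2 y q,
      fun v => expect_first_slot_le_diff hS (expect_codebooks_fst hP hP' h1 h2) hW hPQ v
        fun s y => h.fst_diff s.2 y⟩
  · by_cases h1 : w'.1 = w.1
    · simp only [if_neg h2, if_pos h1]
      exact ⟨expect_first_slot_le_same hS (expect_codebooks_snd hP hP' h1 h2) hW hPQ sel
          fun s y q => h.snd_same s.1 y q,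
        fun v => expect_first_slot_le_diff hS (expect_codebooks_snd hP hP' h1 h2) hW hPQ v
          fun s y => h.snd_diff s.1 y⟩
    · simp only [if_neg h2, if_neg h1]
      exact ⟨expect_first_slot_le_same hS (expect_codebooks_both hP hP' h1 h2) hW hPQ sel
          fun s y q => h.both_same y q,
        fun v => expect_first_slot_le_diff hS (expect_codebooks_both hP hP' h1 h2) hW hPQ v
          fun s y => h.both_diff y⟩

lemma PackingBound.second_slot_le (h : PackingBound P P' PQ T a b) (hP : P ∈ stdSimplex ℝ A)
    (hP' : P' ∈ stdSimplex ℝ A') (hPQ : PQ ∈ stdSimplex ℝ Q) {W : A × A' → Q → Y → ℝ}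
    (hW : ∀ s x, W s x ∈ stdSimplex ℝ Y) {w w' : I × J} (hw : w' ≠ w) (v : U) :
    (expect (codebooks I J P P') (fun ω => expect (prodPmf fun _ : U => PQ) (fun cR =>
      expect (W (ω.1 w.1, ω.2 w.2) (cR v)) (fun y =>
        ind (T (ω.1 w'.1, ω.2 w'.2) y (cR v))))) ≤ a (kind w w')) ∧
    ∀ v', v' ≠ v → expect (codebooks I J P P') (fun ω => expect (prodPmf fun _ : U => PQ) (fun cR =>
      expect (W (ω.1 w.1, ω.2 w.2) (cR v)) (fun y =>
        ind (T (ω.1 w'.1, ω.2 w'.2) y (cR v'))))) ≤ b (kind w w') := by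
  have hS : joinPmf P (fun _ => P') ∈ stdSimplex ℝ (A × A') := joinPmf_mem hP fun _ => hP'
  unfold kind
  by_cases h2 : w'.2 = w.2
  · have h1 : w'.1 ≠ w.1 := fun h1 => hw (Prod.ext h1 h2)
    simp only [if_pos h2]
    exact ⟨expect_second_slot_le_same (T := fun s x y => T s y x) hS
        (expect_codebooks_fst hP hP' h1 h2) hW hPQ v fun s x y => h.fst_same s.2 y x,
      fun v' hv => expect_second_slot_le_diff (T := fun s x y => T s y x) hS
        (expect_codebooks_fst hP hP' h1 h2) hW hPQ hv fun s y => h.fst_diff s.2 y⟩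
  · by_cases h1 : w'.1 = w.1
    · simp only [if_neg h2, if_pos h1]
      exact ⟨expect_second_slot_le_same (T := fun s x y => T s y x) hS
          (expect_codebooks_snd hP hP' h1 h2) hW hPQ v fun s x y => h.snd_same s.1 y x,
        fun v' hv => expect_second_slot_le_diff (T := fun s x y => T s y x) hS
          (expect_codebooks_snd hP hP' h1 h2) hW hPQ hv fun s y => h.snd_diff s.1 y⟩
    · simp only [if_neg h2, if_neg h1]
      exact ⟨expect_second_slot_le_same (T := fun s x y => T s y x) hS
          (expect_codebooks_both hP hP' h1 h2) hW hPQ v fun s x y => h.both_same y x,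
        fun v' hv => expect_second_slot_le_diff (T := fun s x y => T s y x) hS
          (expect_codebooks_both hP hP' h1 h2) hW hPQ hv fun s y => h.both_diff y⟩

/-- The count is generous: w itself is included, and the indicators for the first two kinds overlap
with the term for the third. All extra terms are nonnegative. -/
lemma sum_kind_le {f : Fin 3 → ℝ} (hf : ∀ i, 0 ≤ f i) (w : I × J) :
    ∑ w', f (kind w w') ≤
      Fintype.card I * f 0 + Fintype.card J * f 1 + Fintype.card I * Fintype.card J * f 2 := by
  calc ∑ w', f (kind w w') ≤ ∑ w' : I × J, ((if w'.2 = w.2 then f 0 else 0) +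
        (if w'.1 = w.1 then f 1 else 0) + f 2) := by
        refine Finset.sum_le_sum fun w' _ => ?_
        have := hf 0
        have := hf 1
        have := hf 2
        unfold kind
        split_ifs <;> linarith
    _ = _ := by
        have h1 : ∑ w' : I × J, (if w'.1 = w.1 then f 1 else 0) = Fintype.card J * f 1 := by
          rw [Fintype.sum_prod_type, Finset.sum_comm]
          simp
        rw [Finset.sum_add_distrib, Finset.sum_add_distrib, h1]
        simp [Fintype.sum_prod_type]

end PackingBound

/-! ### Block laws of the two slots -/

section Channel

variable {X11 X21 X12 X22 XR YR Y11 Y12 : Type*} [Fintype YR] [Fintype Y11] [Fintype Y12]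

/-- The law of the received sequences in the first slot. -/
def Channel.firstSlot (ch : Channel X11 X21 X12 X22 XR YR Y11 Y12) {n : ℕ}
    (s : (Fin n → X11) × (Fin n → X21)) : (Fin n → YR) × (Fin n → Y11) → ℝ :=
  fun y => ∏ i, ch.slot1 (s.1 i) (s.2 i) (y.1 i, y.2 i)

/-- The law of the received sequence in the second slot. -/
def Channel.secondSlot (ch : Channel X11 X21 X12 X22 XR YR Y11 Y12) {m : ℕ}
    (s : (Fin m → X12) × (Fin m → X22)) (x : Fin m → XR) : (Fin m → Y12) → ℝ :=
  prodPmf fun i => ch.slot2 (s.1 i) (s.2 i) (x i)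

variable (ch : Channel X11 X21 X12 X22 XR YR Y11 Y12)

lemma expect_firstSlot {n : ℕ} (s : (Fin n → X11) × (Fin n → X21))
    (f : (Fin n → YR) × (Fin n → Y11) → ℝ) :
    expect (ch.firstSlot s) f = expect (prodPmf fun i => ch.slot1 (s.1 i) (s.2 i))
      (fun y => f (fun i => (y i).1, fun i => (y i).2)) := by
  symm
  exact Fintype.sum_equiv (Equiv.arrowProdEquivProdArrow (Fin n) (fun _ => YR) (fun _ => Y11)) _ _
    fun y => rfl

lemma firstSlot_mem {n : ℕ} (s : (Fin n → X11) × (Fin n → X21)) :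
    ch.firstSlot s ∈ stdSimplex ℝ ((Fin n → YR) × (Fin n → Y11)) := by
  refine ⟨fun y => Finset.prod_nonneg fun i _ => (ch.slot1_mem _ _).1 _, ?_⟩
  have := expect_firstSlot ch s fun _ => 1
  rw [expect_const (prodPmf_mem fun i => ch.slot1_mem _ _)] at this
  simpa [expect] using this

lemma secondSlot_mem {m : ℕ} (s : (Fin m → X12) × (Fin m → X22)) (x : Fin m → XR) :
    ch.secondSlot s x ∈ stdSimplex ℝ (Fin m → Y12) :=
  prodPmf_mem fun _ => ch.slot2_mem _ _ _

end Channel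

/-! ### Codes built from given codebooks, and their average error -/

section Code

variable {X11 X21 X12 X22 XR YR Y11 Y12 YQ : Type*}
  [Fintype X11] [Fintype X21] [Fintype X12] [Fintype X22] [Fintype XR]
  [Fintype YR] [Fintype Y11] [Fintype Y12] [Fintype YQ]

/-- The relay's test: joint typicality of its observation and a quantization sequence. -/
def RelayTest (ch : Channel X11 X21 X12 X22 XR YR Y11 Y12) (d : InputDist X11 X21 X12 X22 XR YR YQ)
    (ε : ℝ) {n : ℕ} (y : Fin n → YR) (q : Fin n → YQ) : Prop :=
  (fun i => (y i, q i)) ∈ typicalSet (law (joint1 ch d) fun (_, _, yR, _, q) => (yR, q)) ε n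

/-- The decoding test in the first slot. -/
def FirstTest (ch : Channel X11 X21 X12 X22 XR YR Y11 Y12) (d : InputDist X11 X21 X12 X22 XR YR YQ)
    (ε : ℝ) {n : ℕ} (s : (Fin n → X11) × (Fin n → X21)) (y : Fin n → Y11) (q : Fin n → YQ) : Prop :=
  (fun i => (s.1 i, s.2 i, y i, q i)) ∈
    typicalSet (law (joint1 ch d) fun (x11, x21, _, y11, q) => (x11, x21, y11, q)) ε n

/-- The decoding test in the second slot. -/
def SecondTest (ch : Channel X11 X21 X12 X22 XR YR Y11 Y12) (d : InputDist X11 X21 X12 X22 XR YR YQ)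
    (ε : ℝ) {m : ℕ} (s : (Fin m → X12) × (Fin m → X22)) (y : Fin m → Y12) (x : Fin m → XR) : Prop :=
  (fun i => (s.1 i, s.2 i, x i, y i)) ∈ typicalSet (joint2 ch d) ε m

variable (ch : Channel X11 X21 X12 X22 XR YR Y11 Y12) (d : InputDist X11 X21 X12 X22 XR YR YQ)

lemma joint1_mem : joint1 ch d ∈ stdSimplex ℝ (X11 × X21 × YR × Y11 × YQ) := by
  have h := joinPmf_mem d.p11_mem fun x11 => joinPmf_mem d.p21_mem fun x21 =>
    joinPmf_mem (ch.slot1_mem x11 x21) fun y => d.quant_mem y.1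
  refine ⟨fun z => mul_nonneg (mul_nonneg (mul_nonneg (d.p11_mem.1 _) (d.p21_mem.1 _))
    ((ch.slot1_mem _ _).1 _)) ((d.quant_mem _).1 _), ?_⟩
  rw [← h.2]
  simp only [Fintype.sum_prod_type, joinPmf, joint1, mul_assoc]

lemma joint2_mem : joint2 ch d ∈ stdSimplex ℝ (X12 × X22 × XR × Y12) := by
  have h := joinPmf_mem d.p12_mem fun x12 => joinPmf_mem d.p22_mem fun x22 =>
    joinPmf_mem d.pR_mem fun x => ch.slot2_mem x12 x22 x
  refine ⟨fun z => mul_nonneg (mul_nonneg (mul_nonneg (d.p12_mem.1 _) (d.p22_mem.1 _))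
    (d.pR_mem.1 _)) ((ch.slot2_mem _ _ _).1 _), ?_⟩
  rw [← h.2]
  simp only [Fintype.sum_prod_type, joinPmf, joint2, mul_assoc]

open Classical in
/-- An index whose quantization sequence passes the relay's test, if there is one. -/
def select (ε' : ℝ) {n MU : ℕ} (hMU : 0 < MU) (cq : Fin MU → Fin n → YQ) (y : Fin n → YR) :
    Fin MU :=
  if h : ∃ u, RelayTest ch d ε' y (cq u) then h.choose else ⟨0, hMU⟩

lemma relayTest_select (ε' : ℝ) {n MU : ℕ} (hMU : 0 < MU) (cq : Fin MU → Fin n → YQ)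
    (y : Fin n → YR) (h : ∃ u, RelayTest ch d ε' y (cq u)) :
    RelayTest ch d ε' y (cq (select ch d ε' hMU cq y)) := by
  rw [select, dif_pos h]
  exact h.choose_spec

open Classical in
/-- The GQF code with given codebooks. -/
def gqfCode (ε' ε : ℝ) {n m M1 M2 MU : ℕ} (hMU : 0 < MU)
    (c1 : (Fin M1 → Fin n → X11) × (Fin M2 → Fin n → X21)) (cq : Fin MU → Fin n → YQ)
    (c2 : (Fin M1 → Fin m → X12) × (Fin M2 → Fin m → X22)) (cR : Fin MU → Fin m → XR) :
    Code X11 X21 X12 X22 XR YR Y11 Y12 n m M1 M2 where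
  enc11 := c1.1
  enc12 := c2.1
  enc21 := c1.2
  enc22 := c2.2
  relay y := cR (select ch d ε' hMU cq y)
  dec y11 y12 :=
    if h : ∃ w : Fin M1 × Fin M2, ∀ w', (∃ u, FirstTest ch d ε (c1.1 w'.1, c1.2 w'.2) y11 (cq u) ∧
      SecondTest ch d ε (c2.1 w'.1, c2.2 w'.2) y12 (cR u)) ↔ w' = w then some h.choose else none

section

variable {ε' ε : ℝ} {n m M1 M2 MU : ℕ} (hMU : 0 < MU)
    (c1 : (Fin M1 → Fin n → X11) × (Fin M2 → Fin n → X21)) (cq : Fin MU → Fin n → YQ)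
    (c2 : (Fin M1 → Fin m → X12) × (Fin M2 → Fin m → X22)) (cR : Fin MU → Fin m → XR)

lemma gqfCode_dec_eq_some (y11 : Fin n → Y11) (y12 : Fin m → Y12) (w : Fin M1 × Fin M2) :
    (gqfCode ch d ε' ε hMU c1 cq c2 cR).dec y11 y12 = some w ↔
      ∀ w' : Fin M1 × Fin M2, (∃ u, FirstTest ch d ε (c1.1 w'.1, c1.2 w'.2) y11 (cq u) ∧
        SecondTest ch d ε (c2.1 w'.1, c2.2 w'.2) y12 (cR u)) ↔ w' = w := by
  simp only [gqfCode]
  split_ifs with h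
  · rw [Option.some_inj]
    constructor
    · rintro rfl
      exact h.choose_spec
    · intro hw
      exact (hw _).1 ((h.choose_spec _).2 rfl)
  · simp only [false_iff]
    exact fun hw => h ⟨w, hw⟩

lemma gqfCode_isGQF : (gqfCode ch d ε' ε hMU c1 cq c2 cR).IsGQF ch d ε' ε MU :=
  ⟨cq, cR, select ch d ε' hMU cq, fun y hy => relayTest_select ch d ε' hMU cq y hy, fun _ => rfl,
    fun y11 y12 w => gqfCode_dec_eq_some ch d hMU c1 cq c2 cR y11 y12 w⟩

/-- The probability that the decoder does not output `w`, if `w` is sent. -/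
def failureProb (ε' ε : ℝ) (hMU : 0 < MU)
    (c1 : (Fin M1 → Fin n → X11) × (Fin M2 → Fin n → X21)) (cq : Fin MU → Fin n → YQ)
    (c2 : (Fin M1 → Fin m → X12) × (Fin M2 → Fin m → X22)) (cR : Fin MU → Fin m → XR)
    (w : Fin M1 × Fin M2) : ℝ :=
  expect (ch.firstSlot (c1.1 w.1, c1.2 w.2)) fun y =>
    expect (ch.secondSlot (c2.1 w.1, c2.2 w.2) (cR (select ch d ε' hMU cq y.1))) fun y12 =>
      ind ((gqfCode ch d ε' ε hMU c1 cq c2 cR).dec y.2 y12 ≠ some w)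

lemma errorProb_gqfCode :
    (gqfCode ch d ε' ε hMU c1 cq c2 cR).errorProb ch =
      ∑ w, (1 / ((M1 : ℝ) * M2)) * failureProb ch d ε' ε hMU c1 cq c2 cR w := by
  rw [Code.errorProb, ← Finset.mul_sum, Fintype.sum_prod_type]
  congr 1
  refine Finset.sum_congr rfl fun w1 _ => Finset.sum_congr rfl fun w2 _ => ?_
  simp only [failureProb, expect, Fintype.sum_prod_type, Finset.mul_sum]
  refine Finset.sum_congr rfl fun yR _ => Finset.sum_congr rfl fun y11 _ =>
    Finset.sum_congr rfl fun y12 _ => ?_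
  rw [mul_assoc]
  congr 2
  by_cases h : (gqfCode ch d ε' ε hMU c1 cq c2 cR).dec y11 y12 = some (w1, w2) <;> simp [ind, h]

end

/-- The scheme as a two-stage experiment for `expect_failure_le`: the first stage is (c1, cq,
first-slot outputs), the second (c2, cR, second-slot output). They interact only through the relay's
index. -/
lemma expect_failureProb_le {ε' ε : ℝ} {n m M1 M2 MU : ℕ} (hMU : 0 < MU)
    {pQ : YQ → ℝ} (hpQ : pQ ∈ stdSimplex ℝ YQ) {e₀ e₁ e₂ : ℝ}
    (h₀ : expect (joinPmf (prodPmf fun _ : Fin n => d.p11) fun _ => prodPmf fun _ : Fin n => d.p21)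
      (fun s => expect (ch.firstSlot s) fun y => (1 - expect (prodPmf fun _ : Fin n => pQ)
        (fun q => ind (RelayTest ch d ε' y.1 q))) ^ MU) ≤ e₀)
    (h₁ : ∀ σ : (Fin n → YR) → (Fin n → YQ),
      expect (joinPmf (prodPmf fun _ : Fin n => d.p11) fun _ => prodPmf fun _ : Fin n => d.p21)
        (fun s => expect (ch.firstSlot s) fun y =>
          ind (RelayTest ch d ε' y.1 (σ y.1) ∧ ¬FirstTest ch d ε s y.2 (σ y.1))) ≤ e₁)
    (h₂ : expect (joinPmf (prodPmf fun _ : Fin m => d.p12) fun _ => prodPmf fun _ : Fin m => d.p22)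
      (fun s => expect (prodPmf fun _ : Fin m => d.pR) fun x => expect (ch.secondSlot s x) fun y =>
        ind (¬SecondTest ch d ε s y x)) ≤ e₂)
    {a₁ b₁ a₂ b₂ : Fin 3 → ℝ} (ha₁ : ∀ i, 0 ≤ a₁ i) (hb₁ : ∀ i, 0 ≤ b₁ i) (ha₂ : ∀ i, 0 ≤ a₂ i)
    (hb₂ : ∀ i, 0 ≤ b₂ i)
    (hp₁ : PackingBound (prodPmf fun _ : Fin n => d.p11) (prodPmf fun _ : Fin n => d.p21)
      (prodPmf fun _ : Fin n => pQ) (FirstTest ch d ε) a₁ b₁)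
    (hp₂ : PackingBound (prodPmf fun _ : Fin m => d.p12) (prodPmf fun _ : Fin m => d.p22)
      (prodPmf fun _ : Fin m => d.pR) (SecondTest ch d ε) a₂ b₂) (w : Fin M1 × Fin M2) :
    expect (codebooks (Fin M1) (Fin M2) (prodPmf fun _ : Fin n => d.p11)
      (prodPmf fun _ : Fin n => d.p21)) (fun c1 =>
      expect (prodPmf fun _ : Fin MU => prodPmf fun _ : Fin n => pQ) fun cq =>
      expect (codebooks (Fin M1) (Fin M2) (prodPmf fun _ : Fin m => d.p12)
        (prodPmf fun _ : Fin m => d.p22)) fun c2 =>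
      expect (prodPmf fun _ : Fin MU => prodPmf fun _ : Fin m => d.pR) fun cR =>
      failureProb ch d ε' ε hMU c1 cq c2 cR w) ≤
      e₀ + e₁ + e₂ + (M1 * (a₁ 0 * a₂ 0 + MU * (b₁ 0 * b₂ 0)) +
        M2 * (a₁ 1 * a₂ 1 + MU * (b₁ 1 * b₂ 1)) +
        M1 * M2 * (a₁ 2 * a₂ 2 + MU * (b₁ 2 * b₂ 2))) := by
  have m11 := prodPmf_mem fun _ : Fin n => d.p11_mem
  have m21 := prodPmf_mem fun _ : Fin n => d.p21_mem
  have m12 := prodPmf_mem fun _ : Fin m => d.p12_mem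
  have m22 := prodPmf_mem fun _ : Fin m => d.p22_mem
  have mR := prodPmf_mem fun _ : Fin m => d.pR_mem
  have mQ := prodPmf_mem fun _ : Fin n => hpQ
  have mcR := prodPmf_mem fun _ : Fin MU => mR
  have mcQ := prodPmf_mem fun _ : Fin MU => mQ
  have mc1 := codebooks_mem (I := Fin M1) (J := Fin M2) m11 m21
  have mc2 := codebooks_mem (I := Fin M1) (J := Fin M2) m12 m22
  have m1 := joinPmf_mem mc1 fun c1 => joinPmf_mem mcQ fun _ => firstSlot_mem ch (c1.1 w.1, c1.2 w.2)
  have m2 := fun v : Fin MU => joinPmf_mem mc2 fun c2 => joinPmf_mem mcR fun cR =>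
    secondSlot_mem ch (c2.1 w.1, c2.2 w.2) (cR v)
  set sel := select ch d ε' (n := n) hMU with hsel
  have key := expect_failure_le (W := Fin M1 × Fin M2) m1 m2 (fun t => sel t.2.1 t.2.2.1) (w := w)
    (err := fun t₁ t₂ => (gqfCode ch d ε' ε hMU t₁.1 t₁.2.1 t₂.1 t₂.2.1).dec t₁.2.2.2 t₂.2.2 ≠ some w)
    (F₀ := fun t => ¬RelayTest ch d ε' t.2.2.1 (t.2.1 (sel t.2.1 t.2.2.1)))
    (F₁ := fun t => RelayTest ch d ε' t.2.2.1 (t.2.1 (sel t.2.1 t.2.2.1)) ∧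
      ¬FirstTest ch d ε (t.1.1 w.1, t.1.2 w.2) t.2.2.2 (t.2.1 (sel t.2.1 t.2.2.1)))
    (F₂ := fun v t => ¬SecondTest ch d ε (t.1.1 w.1, t.1.2 w.2) t.2.2 (t.2.1 v))
    (G₁ := fun w' v t => FirstTest ch d ε (t.1.1 w'.1, t.1.2 w'.2) t.2.2.2 (t.2.1 v))
    (G₂ := fun w' v t => SecondTest ch d ε (t.1.1 w'.1, t.1.2 w'.2) t.2.2 (t.2.1 v))
    (e₀ := e₀) (e₁ := e₁) (e₂ := e₂)
    (b := fun w' => a₁ (kind w w') * a₂ (kind w w') +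
      MU * (b₁ (kind w w') * b₂ (kind w w')))
    ?_ ?_ ?_ ?_ ?_ ?_
  · refine le_trans (le_of_eq ?_) (key.trans (add_le_add_right ?_ _))
    · rw [expect_joinPmf]
      congr 1; funext c1
      rw [expect_joinPmf]
      congr 1; funext cq
      simp only [failureProb, expect_joinPmf]
      -- The statement averages over all codebooks before the outputs, `key` stage by stage; only
      -- the order of summation differs.
      conv_rhs => rw [expect_comm]
      congr 1; funext c2
      exact expect_comm _ _ _
    · refine (sum_kind_le (f := fun i => a₁ i * a₂ i + MU * (b₁ i * b₂ i)) (fun i => ?_) w).trans_eq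
        (by simp)
      have := ha₁ i
      have := ha₂ i
      have := hb₁ i
      have := hb₂ i
      positivity
  · intro t₁ t₂ h
    rw [Ne, gqfCode_dec_eq_some] at h
    by_contra! hc
    obtain ⟨hc0, hc1, hc2, hc3⟩ := hc
    refine h fun w' => ⟨?_, ?_⟩
    · rintro ⟨u, hu1, hu2⟩
      by_contra hne
      exact hc3 w' hne u hu1 hu2
    · rintro rfl
      exact ⟨sel t₁.2.1 t₁.2.2.1, hc1 hc0, hc2⟩
  · simp only [expect_joinPmf]
    refine le_trans ?_ h₀
    rw [← expect_codebooks m11 m21 w fun s => expect (ch.firstSlot s) fun y =>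
      (1 - expect (prodPmf fun _ : Fin n => pQ) (fun q => ind (RelayTest ch d ε' y.1 q))) ^ MU]
    refine expect_mono mc1.1 fun c1 => ?_
    rw [expect_comm]
    refine expect_mono (firstSlot_mem ch _).1 fun y => ?_
    -- By independence of the quantization codewords, the probability that all fail is a power.
    have h1 := expect_prodPmf_prod (fun _ : Fin MU => prodPmf fun _ : Fin n => pQ)
      (fun _ q => ind (¬RelayTest ch d ε' y.1 q))
    simp only [ind_not, expect_sub, expect_const mQ, Finset.prod_const, Finset.card_univ,
      Fintype.card_fin] at h1
    rw [← h1]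
    refine expect_mono mcQ.1 fun cq => ?_
    by_cases hcq : ∃ u, RelayTest ch d ε' y.1 (cq u)
    · rw [ind_of_not (not_not.2 (relayTest_select ch d ε' hMU cq y.1 hcq))]
      exact Finset.prod_nonneg fun u _ => sub_nonneg.2 (ind_le_one _)
    · refine (ind_le_one _).trans_eq ?_
      push Not at hcq
      simp [ind_of_not (hcq _)]
  · simp only [expect_joinPmf]
    -- With the quantization codebook frozen, the selected codeword is a function of y_R^n alone, as
    -- `h₁` requires.
    refine expect_swap_le mcQ fun cq => ?_
    refine le_trans (le_of_eq ?_) (h₁ fun y => cq (sel cq y))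
    exact expect_codebooks m11 m21 w fun s => expect (ch.firstSlot s) fun y =>
      ind (RelayTest ch d ε' y.1 (cq (sel cq y.1)) ∧ ¬FirstTest ch d ε s y.2 (cq (sel cq y.1)))
  · intro v
    simp only [expect_joinPmf]
    refine le_trans (le_of_eq ?_) h₂
    rw [← expect_codebooks m12 m22 w fun s => expect (prodPmf fun _ : Fin m => d.pR) fun x =>
      expect (ch.secondSlot s x) fun y => ind (¬SecondTest ch d ε s y x)]
    congr 1; funext c2
    exact expect_prodPmf_eval (fun _ => mR) v fun x =>
      expect (ch.secondSlot (c2.1 w.1, c2.2 w.2) x) fun y =>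
        ind (¬SecondTest ch d ε (c2.1 w.1, c2.2 w.2) y x)
  · intro w'
    have := ha₁ (kind w w')
    have := ha₂ (kind w w')
    have := hb₁ (kind w w')
    have := hb₂ (kind w w')
    positivity
  · intro w' hw
    simp only [expect_joinPmf]
    have k1 := hp₁.first_slot_le m11 m21 mQ (firstSlot_mem ch) sel hw
    have k2 := hp₂.second_slot_le (U := Fin MU) m12 m22 mR (secondSlot_mem ch) hw
    exact ⟨_, _, _, _, ha₂ (kind w w'), hb₂ (kind w w'), k1.1, fun v => (k2 v).1, k1.2,
      fun v v' hv => (k2 v).2 v' hv, by simp⟩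

/-- The bound holds for every message pair, hence also on average over messages. Fixing the four
codebooks one after another keeps the value at most e. -/
lemma exists_isGQF_errorProb_le {ε' ε : ℝ} {n m M1 M2 MU : ℕ} (hM1 : 0 < M1) (hM2 : 0 < M2)
    (hMU : 0 < MU) {pQ : YQ → ℝ} (hpQ : pQ ∈ stdSimplex ℝ YQ) {e : ℝ}
    (h : ∀ w : Fin M1 × Fin M2, expect (codebooks (Fin M1) (Fin M2) (prodPmf fun _ : Fin n => d.p11)
      (prodPmf fun _ : Fin n => d.p21)) (fun c1 =>
      expect (prodPmf fun _ : Fin MU => prodPmf fun _ : Fin n => pQ) fun cq =>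
      expect (codebooks (Fin M1) (Fin M2) (prodPmf fun _ : Fin m => d.p12)
        (prodPmf fun _ : Fin m => d.p22)) fun c2 =>
      expect (prodPmf fun _ : Fin MU => prodPmf fun _ : Fin m => d.pR) fun cR =>
      failureProb ch d ε' ε hMU c1 cq c2 cR w) ≤ e) :
    ∃ C : Code X11 X21 X12 X22 XR YR Y11 Y12 n m M1 M2,
      C.IsGQF ch d ε' ε MU ∧ C.errorProb ch ≤ e := by
  have m11 := prodPmf_mem fun _ : Fin n => d.p11_mem
  have m21 := prodPmf_mem fun _ : Fin n => d.p21_mem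
  have m12 := prodPmf_mem fun _ : Fin m => d.p12_mem
  have m22 := prodPmf_mem fun _ : Fin m => d.p22_mem
  have mcR := prodPmf_mem fun _ : Fin MU => prodPmf_mem fun _ : Fin m => d.pR_mem
  have mcQ := prodPmf_mem fun _ : Fin MU => prodPmf_mem fun _ : Fin n => hpQ
  have mc1 := codebooks_mem (I := Fin M1) (J := Fin M2) m11 m21
  have mc2 := codebooks_mem (I := Fin M1) (J := Fin M2) m12 m22
  have hM : (M1 : ℝ) * M2 ≠ 0 := by positivity
  have hsum := Finset.sum_le_sum fun (w : Fin M1 × Fin M2) (_ : w ∈ Finset.univ) =>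
    mul_le_mul_of_nonneg_left (h w) (show (0 : ℝ) ≤ 1 / ((M1 : ℝ) * M2) by positivity)
  simp only [← expect_mul_left, ← expect_sum, ← errorProb_gqfCode] at hsum
  have hR : ∑ _w : Fin M1 × Fin M2, 1 / ((M1 : ℝ) * M2) * e = e := by
    simp
    field_simp
  rw [hR] at hsum
  obtain ⟨c1, h1⟩ := exists_le_of_expect_le mc1 hsum
  obtain ⟨cq, h2⟩ := exists_le_of_expect_le mcQ h1
  obtain ⟨c2, h3⟩ := exists_le_of_expect_le mc2 h2
  obtain ⟨cR, h4⟩ := exists_le_of_expect_le mcR h3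
  exact ⟨_, gqfCode_isGQF ch d hMU c1 cq c2 cR, h4⟩

end Code

/-! ### Conditional laws -/

section Conditional

variable {Z Y ι : Type*} [Fintype Z] [Fintype Y] [Fintype ι] [DecidableEq ι]

lemma expect_ind_eq (p : Z → ℝ) (a : Z) : expect p (fun z => ind (z = a)) = p a := by
  rw [expect, Finset.sum_eq_single a]
  · rw [ind_of rfl, mul_one]
  · intro z _ hz
    rw [ind_of_not hz, mul_zero]
  · simp

open Classical in
/-- The conditional pmf of the sample point given `f = y`. -/
def condPmf {Y : Type*} (p : Z → ℝ) (f : Z → Y) (y : Y) (z : Z) : ℝ :=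
  if law p f y = 0 then p z else p z * ind (f z = y) / law p f y

/-- The default p on null values of f makes this true for every y, so no support condition is needed
when disintegrating. -/
lemma condPmf_mem {Y : Type*} {p : Z → ℝ} (hp : p ∈ stdSimplex ℝ Z) (f : Z → Y) (y : Y) :
    condPmf p f y ∈ stdSimplex ℝ Z := by
  by_cases h : law p f y = 0
  · convert hp using 1
    funext z
    exact if_pos h
  · have h1 : condPmf p f y = fun z => p z * ind (f z = y) / law p f y := by
      funext z
      exact if_neg h
    rw [h1]
    refine ⟨fun z => div_nonneg (mul_nonneg (hp.1 z) (ind_nonneg _)) (law_nonneg hp.1 f y), ?_⟩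
    rw [← Finset.sum_div, div_eq_one_iff_eq h, law_eq_expect]
    rfl

/-- For a null value both sides vanish, so the default in `condPmf` does no harm. -/
lemma law_mul_condPmf {Y : Type*} {p : Z → ℝ} (hp : ∀ z, 0 ≤ p z) (f : Z → Y) (y : Y) (z : Z) :
    law p f y * condPmf p f y z = p z * ind (f z = y) := by
  by_cases h : law p f y = 0
  · by_cases hz : f z = y
    · rcases (hp z).eq_or_lt with h0 | h0
      · rw [h, ← h0]; simp
      · exact absurd h (hz ▸ (law_pos hp f h0).ne')
    · rw [h, ind_of_not hz]; simp
  · rw [condPmf, if_neg h, mul_div_cancel₀ _ h]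

/-- Disintegration of a product pmf along a letterwise map. -/
lemma expect_prodPmf_eq_expect_law {p : Z → ℝ} (hp : ∀ z, 0 ≤ p z) (f : Z → Y)
    (F : (ι → Y) → (ι → Z) → ℝ) :
    expect (prodPmf fun _ : ι => p) (fun z => F (fun i => f (z i)) z) =
      expect (prodPmf fun _ : ι => law p f)
        (fun y => expect (prodPmf fun i => condPmf p f (y i)) (F y)) := by
  simp only [expect, Finset.mul_sum]
  rw [Finset.sum_comm]
  refine Finset.sum_congr rfl fun z _ => ?_
  have h : ∀ y : ι → Y, prodPmf (fun _ => law p f) y * (prodPmf (fun i => condPmf p f (y i)) z * F y z) =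
      (∏ i, p (z i) * ind (f (z i) = y i)) * F y z := by
    intro y
    simp only [prodPmf, ← mul_assoc, ← Finset.prod_mul_distrib, law_mul_condPmf hp]
  simp only [h]
  rw [Finset.sum_eq_single fun i => f (z i)]
  · simp [ind_of, prodPmf]
  · intro y _ hy
    obtain ⟨i, hi⟩ := Function.ne_iff.1 hy
    rw [Finset.prod_eq_zero (Finset.mem_univ i) (by rw [ind_of_not (Ne.symm hi), mul_zero]), zero_mul]
  · simp

lemma expect_eq_expect_law {p : Z → ℝ} (hp : ∀ z, 0 ≤ p z) (f : Z → Y) (F : Y → Z → ℝ) :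
    expect p (fun z => F (f z) z) =
      expect (law p f) (fun y => expect (condPmf p f y) (F y)) := by
  simp only [expect, Finset.mul_sum, ← mul_assoc, law_mul_condPmf hp]
  rw [Finset.sum_comm]
  refine Finset.sum_congr rfl fun z _ => ?_
  rw [Finset.sum_eq_single (f z)]
  · rw [ind_of rfl, mul_one]
  · intro y _ hy
    rw [ind_of_not (Ne.symm hy), mul_zero, zero_mul]
  · simp

end Conditional

section Model

variable {X11 X21 X12 X22 XR YR Y11 Y12 YQ : Type*}
  [Fintype X11] [Fintype X21] [Fintype X12] [Fintype X22] [Fintype XR]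
  [Fintype YR] [Fintype Y11] [Fintype Y12] [Fintype YQ]
  (ch : Channel X11 X21 X12 X22 XR YR Y11 Y12) (d : InputDist X11 X21 X12 X22 XR YR YQ)

/-! ### Laws of the single letters -/

/-- The joint pmf of `(X₁₁, X₂₁, Y_R, Y₁₁)`. -/
def slotOneLaw : X11 × X21 × YR × Y11 → ℝ :=
  joinPmf d.p11 fun x11 => joinPmf d.p21 fun x21 => ch.slot1 x11 x21

lemma slotOneLaw_mem : slotOneLaw ch d ∈ stdSimplex ℝ (X11 × X21 × YR × Y11) :=
  joinPmf_mem d.p11_mem fun x11 => joinPmf_mem d.p21_mem fun x21 => ch.slot1_mem x11 x21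

/-- The pmf of `Y_R`. -/
def relayLaw : YR → ℝ := law (slotOneLaw ch d) fun (_, _, yR, _) => yR

/-- The pmf of `Ŷ_R`. -/
def quantLaw : YQ → ℝ := law (joint1 ch d) fun (_, _, _, _, q) => q

lemma expect_joint1 (f : X11 × X21 × YR × Y11 × YQ → ℝ) :
    expect (joint1 ch d) f = expect (slotOneLaw ch d) (fun z =>
      expect (d.quant z.2.2.1) (fun q => f (z.1, z.2.1, z.2.2.1, z.2.2.2, q))) := by
  simp only [expect, Fintype.sum_prod_type, slotOneLaw, joinPmf, joint1, Finset.mul_sum, mul_assoc]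

lemma expect_slotOneLaw (f : X11 × X21 × YR × Y11 → ℝ) :
    expect (slotOneLaw ch d) f = expect d.p11 (fun x11 => expect d.p21 (fun x21 =>
      expect (ch.slot1 x11 x21) (fun y => f (x11, x21, y)))) := by
  simp only [slotOneLaw, expect_joinPmf]

lemma joint2_eq : joint2 ch d = joinPmf d.p12 fun x12 => joinPmf d.p22 fun x22 =>
    joinPmf d.pR fun x => ch.slot2 x12 x22 x := by
  funext z
  simp only [joint2, joinPmf, mul_assoc]

lemma law_relay_quant :
    law (joint1 ch d) (fun (_, _, yR, _, q) => (yR, q)) = joinPmf (relayLaw ch d) d.quant := by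
  funext z
  obtain ⟨y, q⟩ := z
  have h : ∀ yR, expect (d.quant yR) (fun q' => ind ((yR, q') = (y, q))) =
      ind (yR = y) * d.quant y q := by
    intro yR
    by_cases hy : yR = y
    · subst hy
      simp only [Prod.mk.injEq, true_and, ind_of, one_mul]
      exact expect_ind_eq _ _
    · simp [hy, ind, expect]
  rw [law_eq_expect, expect_joint1]
  simp only [h, expect_mul_right, joinPmf, relayLaw, law_eq_expect]

/-! ### Error events caused by atypical sequences -/

/-- Random codewords of one message pair together with the channel outputs form i.i.d. letters. -/
lemma expect_firstSlot_eq {n : ℕ}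
    (F : (Fin n → X11) → (Fin n → X21) → (Fin n → YR) → (Fin n → Y11) → ℝ) :
    expect (joinPmf (prodPmf fun _ : Fin n => d.p11) fun _ => prodPmf fun _ : Fin n => d.p21)
      (fun s => expect (ch.firstSlot s) fun y => F s.1 s.2 y.1 y.2) =
    expect (prodPmf fun _ : Fin n => slotOneLaw ch d) (fun z => F (fun i => (z i).1)
      (fun i => (z i).2.1) (fun i => (z i).2.2.1) (fun i => (z i).2.2.2)) := by
  rw [expect_joinPmf]
  simp only [expect_firstSlot]
  rw [slotOneLaw, expect_prodPmf_joinPmf (fun _ : Fin n => d.p11)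
    (fun _ x11 => joinPmf d.p21 fun x21 => ch.slot1 x11 x21)
    (fun x z => F x (fun i => (z i).1) (fun i => (z i).2.1) (fun i => (z i).2.2))]
  congr 1; funext x
  exact (expect_prodPmf_joinPmf (fun _ : Fin n => d.p21) (fun i x21 => ch.slot1 (x i) x21)
    (fun x' z => F x x' (fun i => (z i).1) (fun i => (z i).2))).symm

lemma expect_secondSlot_eq {m : ℕ}
    (F : (Fin m → X12) → (Fin m → X22) → (Fin m → XR) → (Fin m → Y12) → ℝ) :
    expect (joinPmf (prodPmf fun _ : Fin m => d.p12) fun _ => prodPmf fun _ : Fin m => d.p22)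
      (fun s => expect (prodPmf fun _ : Fin m => d.pR) fun x => expect (ch.secondSlot s x) fun y =>
        F s.1 s.2 x y) =
    expect (prodPmf fun _ : Fin m => joint2 ch d) (fun z => F (fun i => (z i).1)
      (fun i => (z i).2.1) (fun i => (z i).2.2.1) (fun i => (z i).2.2.2)) := by
  rw [expect_joinPmf, joint2_eq, expect_prodPmf_joinPmf (fun _ : Fin m => d.p12)
    (fun _ x12 => joinPmf d.p22 fun x22 => joinPmf d.pR fun x => ch.slot2 x12 x22 x)
    (fun x z => F x (fun i => (z i).1) (fun i => (z i).2.1) (fun i => (z i).2.2))]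
  congr 1; funext x
  rw [expect_prodPmf_joinPmf (fun _ : Fin m => d.p22)
    (fun i x22 => joinPmf d.pR fun xR => ch.slot2 (x i) x22 xR)
    (fun x' z => F x x' (fun i => (z i).1) (fun i => (z i).2))]
  congr 1; funext x'
  exact (expect_prodPmf_joinPmf (fun _ : Fin m => d.pR) (fun i xR => ch.slot2 (x i) (x' i) xR)
    (fun xR y => F x x' xR y)).symm

lemma expect_not_secondTest_le {ε : ℝ} (hε : 0 < ε) {m : ℕ} (hm : 0 < m) :
    expect (joinPmf (prodPmf fun _ : Fin m => d.p12) fun _ => prodPmf fun _ : Fin m => d.p22)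
      (fun s => expect (prodPmf fun _ : Fin m => d.pR) fun x => expect (ch.secondSlot s x) fun y =>
        ind (¬SecondTest ch d ε s y x)) ≤ (∑ z, 1 / (ε * joint2 ch d z) ^ 2) / m := by
  have hr := joint2_mem ch d
  have h := expect_not_typical_le (r := joint2 ch d) hr.1 hε hm (fun _ => hr) (fun _ z => z) (by
    intro z
    simp only [expect_ind_eq]
    have hm' : (m : ℝ) ≠ 0 := by positivity
    simp [hm'])
  rw [sub_zero] at h
  refine le_trans (le_of_eq ?_) h
  exact expect_secondSlot_eq ch d fun x x' xR y => ind (¬SecondTest ch d ε (x, x') y xR)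

/-- Here σ is the relay's choice for a fixed codebook. Given y_R^n the sequence σ(y_R^n) is
deterministic and the other letters are independent with their conditional laws; joint typicality
with y_R^n makes the average of these laws ε'-close to the target, and Chebyshev applies. -/
lemma expect_relayTest_not_firstTest_le {ε' ε : ℝ} (hε : ε' < ε) {n : ℕ} (hn : 0 < n)
    (σ : (Fin n → YR) → (Fin n → YQ)) :
    expect (joinPmf (prodPmf fun _ : Fin n => d.p11) fun _ => prodPmf fun _ : Fin n => d.p21)
        (fun s => expect (ch.firstSlot s) fun y =>
          ind (RelayTest ch d ε' y.1 (σ y.1) ∧ ¬FirstTest ch d ε s y.2 (σ y.1))) ≤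
      (∑ a, 1 / ((ε - ε') * law (joint1 ch d)
        (fun (x11, x21, _, y11, q) => (x11, x21, y11, q)) a) ^ 2) / n := by
  have hr := slotOneLaw_mem ch d
  set f : X11 × X21 × YR × Y11 → YR := fun (_, _, yR, _) => yR with hf
  set r := law (joint1 ch d) (fun (x11, x21, _, y11, q) => (x11, x21, y11, q)) with hr1
  have hr0 : ∀ a, 0 ≤ r a := law_nonneg (joint1_mem ch d).1 _
  refine (expect_firstSlot_eq ch d fun x x' yR y =>
    ind (RelayTest ch d ε' yR (σ yR) ∧ ¬FirstTest ch d ε (x, x') y (σ yR))).trans_le ?_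
  rw [expect_prodPmf_eq_expect_law hr.1 f (fun yR z => ind (RelayTest ch d ε' yR (σ yR) ∧
    ¬FirstTest ch d ε (fun i => (z i).1, fun i => (z i).2.1) (fun i => (z i).2.2.2) (σ yR)))]
  refine expect_le (prodPmf_mem fun _ => law_mem hr f) fun yR => ?_
  have hc := fun i => condPmf_mem hr f (yR i)
  by_cases hT : RelayTest ch d ε' yR (σ yR)
  · simp only [hT, true_and]
    refine expect_not_typical_le (r := r) hr0 hε hn hc
      (fun i z => (z.1, z.2.1, z.2.2.2, σ yR i)) fun a => ?_
    -- The conditional probability of the letter a given the pair (y_R, ŷ_R). Since φ ≥ 0, its mean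
    -- along the typical pair has relative error ε'.
    set φ : YR × YQ → ℝ := fun y => expect (condPmf (slotOneLaw ch d) f y.1)
      (fun z => ind ((z.1, z.2.1, z.2.2.2, y.2) = a)) with hφ
    have h1 := abs_sum_sub_le_of_mem_typicalSet hT φ
    have h2 : ∀ y, |φ y| = φ y := fun y =>
      abs_of_nonneg (expect_nonneg (condPmf_mem hr f y.1).1 fun _ => ind_nonneg _)
    -- Given Y_R, the quantized letter is independent of the rest, so averaging φ returns the joint
    -- law.
    have h3 : expect (law (joint1 ch d) fun (_, _, yR, _, q) => (yR, q)) φ = r a := by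
      rw [law_relay_quant, expect_joinPmf, hr1, law_eq_expect, expect_joint1]
      rw [expect_eq_expect_law hr.1 f (fun y z => expect (d.quant y) fun q =>
        ind ((z.1, z.2.1, z.2.2.2, q) = a))]
      refine congrArg (expect (relayLaw ch d)) (funext fun y => ?_)
      exact expect_comm (d.quant y) (condPmf (slotOneLaw ch d) f y)
        (fun q z => ind ((z.1, z.2.1, z.2.2.2, q) = a))
    simp only [h2, h3] at h1
    have hn' : (0 : ℝ) < n := Nat.cast_pos.2 hn
    rw [div_sub' hn'.ne', abs_div, abs_of_pos hn', div_le_iff₀ hn', mul_comm (ε' * r a)]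
    exact h1
  · simp only [hT, false_and, ind_of_not not_false]
    rw [expect_const (prodPmf_mem hc)]
    exact div_nonneg (Finset.sum_nonneg fun a _ => by positivity) (Nat.cast_nonneg n)

end Model

section Rates

variable {X11 X21 X12 X22 XR YR Y11 Y12 YQ : Type*}
  [Fintype X11] [Fintype X21] [Fintype X12] [Fintype X22] [Fintype XR]
  [Fintype YR] [Fintype Y11] [Fintype Y12] [Fintype YQ]
  (ch : Channel X11 X21 X12 X22 XR YR Y11 Y12) (d : InputDist X11 X21 X12 X22 XR YR YQ)

/-! ### Marginal laws -/

lemma law_joint1_x11 (a : X11) : law (joint1 ch d) (fun (x11, _, _, _, _) => x11) a = d.p11 a := by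
  rw [law_eq_expect, expect_joint1]
  simp only [expect_const (d.quant_mem _), expect_slotOneLaw, expect_const (ch.slot1_mem _ _),
    expect_const d.p21_mem, expect_ind_eq]

lemma law_joint1_x21 (a : X21) : law (joint1 ch d) (fun (_, x21, _, _, _) => x21) a = d.p21 a := by
  rw [law_eq_expect, expect_joint1]
  simp only [expect_const (d.quant_mem _), expect_slotOneLaw, expect_const (ch.slot1_mem _ _),
    expect_const d.p11_mem, expect_ind_eq]

lemma law_joint1_x11_x21 (a : X11 × X21) :
    law (joint1 ch d) (fun (x11, x21, _, _, _) => (x11, x21)) a =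
      joinPmf d.p11 (fun _ => d.p21) a := by
  rw [law_eq_expect, expect_joint1]
  simp only [expect_const (d.quant_mem _), expect_slotOneLaw, expect_const (ch.slot1_mem _ _)]
  rw [← expect_joinPmf d.p11 (fun _ => d.p21) (fun z => ind (z = a)), expect_ind_eq]

lemma law_joint1_yR (a : YR) :
    law (joint1 ch d) (fun (_, _, yR, _, _) => yR) a = relayLaw ch d a := by
  rw [law_eq_expect, expect_joint1]
  simp only [expect_const (d.quant_mem _), relayLaw, law_eq_expect]

lemma law_joint2_x12 (a : X12) : law (joint2 ch d) (fun (x12, _, _, _) => x12) a = d.p12 a := by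
  rw [law_eq_expect, joint2_eq]
  simp only [expect_joinPmf, expect_const (ch.slot2_mem _ _ _), expect_const d.pR_mem,
    expect_const d.p22_mem, expect_ind_eq]

lemma law_joint2_x22 (a : X22) : law (joint2 ch d) (fun (_, x22, _, _) => x22) a = d.p22 a := by
  rw [law_eq_expect, joint2_eq]
  simp only [expect_joinPmf, expect_const (ch.slot2_mem _ _ _), expect_const d.pR_mem,
    expect_const d.p12_mem, expect_ind_eq]

lemma law_joint2_x12_x22 (a : X12 × X22) :
    law (joint2 ch d) (fun (x12, x22, _, _) => (x12, x22)) a =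
      joinPmf d.p12 (fun _ => d.p22) a := by
  rw [law_eq_expect, joint2_eq]
  simp only [expect_joinPmf, expect_const (ch.slot2_mem _ _ _), expect_const d.pR_mem]
  rw [← expect_joinPmf d.p12 (fun _ => d.p22) (fun z => ind (z = a)), expect_ind_eq]

lemma law_joint2_xR_x12 (a : XR × X12) :
    law (joint2 ch d) (fun (x12, _, xR, _) => (xR, x12)) a =
      joinPmf d.pR (fun _ => d.p12) a := by
  rw [law_eq_expect, joint2_eq]
  simp only [expect_joinPmf, expect_const (ch.slot2_mem _ _ _), expect_const d.p22_mem]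
  rw [expect_comm, ← expect_joinPmf d.pR (fun _ => d.p12) (fun z => ind (z = a)), expect_ind_eq]

lemma law_joint2_xR_x22 (a : XR × X22) :
    law (joint2 ch d) (fun (_, x22, xR, _) => (xR, x22)) a =
      joinPmf d.pR (fun _ => d.p22) a := by
  rw [law_eq_expect, joint2_eq]
  simp only [expect_joinPmf, expect_const (ch.slot2_mem _ _ _), expect_const d.p12_mem]
  rw [expect_comm, ← expect_joinPmf d.pR (fun _ => d.p22) (fun z => ind (z = a)), expect_ind_eq]

lemma law_joint2_xR_x12_x22 (a : XR × X12 × X22) :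
    law (joint2 ch d) (fun (x12, x22, xR, _) => (xR, x12, x22)) a =
      joinPmf d.pR (fun _ => joinPmf d.p12 fun _ => d.p22) a := by
  rw [law_eq_expect, joint2_eq]
  simp only [expect_joinPmf, expect_const (ch.slot2_mem _ _ _)]
  simp only [fun x : X12 => expect_comm d.p22 d.pR fun x' xR => ind ((xR, x, x') = a)]
  rw [expect_comm, ← expect_ind_eq (joinPmf d.pR (fun _ => joinPmf d.p12 fun _ => d.p22)) a]
  simp only [expect_joinPmf]

/-- The value is -H(Ŷ_R | Y_R), because p(y_R, ŷ_R) factors through the quantizer. -/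
lemma expect_logb_quant :
    expect (joint1 ch d) (fun (_, _, yR, _, q) => Real.logb 2 (d.quant yR q)) =
      entropy (joint1 ch d) (fun (_, _, yR, _, _) => yR) -
        entropy (joint1 ch d) (fun (_, _, yR, _, q) => (yR, q)) := by
  have hp := (joint1_mem ch d).1
  rw [entropy_eq_expect, entropy_eq_expect, sub_neg_eq_add, neg_add_eq_sub, ← expect_sub]
  refine expect_congr_of_pos hp fun ω hω => ?_
  have h1 := law_pos hp (fun ω => ω.2.2.1) hω
  have h2 := law_pos hp (fun ω => (ω.2.2.1, ω.2.2.2.2)) hω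
  rw [law_joint1_yR] at h1 ⊢
  rw [law_relay_quant] at h2 ⊢
  simp only [joinPmf] at h2 ⊢
  rw [Real.logb_mul h1.ne' (pos_of_mul_pos_right h2 h1.le).ne', add_sub_cancel_left]

/-- The Markov chain Ŷ_R – Y_R – (X₁₁, X₂₁, Y₁₁) in entropies: log p(ŷ_R | y_R) splits off the
logarithm of the joint pmf. It turns I(Ŷ_R; Y_R | X₁₁, X₂₁, Y₁₁) into H(Ŷ_R | X₁₁, X₂₁, Y₁₁) - H(Ŷ_R
| Y_R). -/
lemma entropy_joint1 :
    entropy (joint1 ch d) (fun (x11, x21, yR, y11, q) => (q, yR, x11, x21, y11)) =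
      entropy (joint1 ch d) (fun (x11, x21, yR, y11, _) => (yR, x11, x21, y11)) +
        entropy (joint1 ch d) (fun (_, _, yR, _, q) => (yR, q)) -
          entropy (joint1 ch d) (fun (_, _, yR, _, _) => yR) := by
  have hp := (joint1_mem ch d).1
  have h0 : entropy (joint1 ch d) (fun (x11, x21, yR, y11, q) => (q, yR, x11, x21, y11)) =
      entropy (joint1 ch d) (fun ω => ω) := entropy_congr _ fun ω ω' => by
    simp only [Prod.ext_iff]; tauto
  have h1 : entropy (joint1 ch d) (fun (x11, x21, yR, y11, _) => (yR, x11, x21, y11)) =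
      entropy (joint1 ch d) (fun (x11, x21, yR, y11, _) => (x11, x21, yR, y11)) :=
    entropy_congr _ fun ω ω' => by simp only [Prod.ext_iff]; tauto
  have hl : ∀ a, law (joint1 ch d) (fun ω => ω) a = joint1 ch d a := fun a => by
    rw [law_eq_expect, expect_ind_eq]
  have hl' : ∀ a, law (joint1 ch d) (fun (x11, x21, yR, y11, _) => (x11, x21, yR, y11)) a =
      slotOneLaw ch d a := fun a => by
    rw [law_eq_expect, expect_joint1]
    simp only [expect_const (d.quant_mem _)]
    exact expect_ind_eq _ _
  have h2 := expect_logb_quant ch d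
  have h3 : -entropy (joint1 ch d) (fun ω => ω) =
      -entropy (joint1 ch d) (fun (x11, x21, yR, y11, _) => (x11, x21, yR, y11)) +
      expect (joint1 ch d) (fun (_, _, yR, _, q) => Real.logb 2 (d.quant yR q)) := by
    rw [← entropy_eq_of_law hl, ← entropy_eq_of_law hl', ← expect_add]
    refine expect_congr_of_pos hp fun ω hω => ?_
    have h4 := law_pos hp (fun ω => (ω.1, ω.2.1, ω.2.2.1, ω.2.2.2.1)) hω
    rw [hl'] at h4
    have h5 : joint1 ch d ω = slotOneLaw ch d (ω.1, ω.2.1, ω.2.2.1, ω.2.2.2.1) *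
        d.quant ω.2.2.1 ω.2.2.2.2 := by
      simp only [joint1, slotOneLaw, joinPmf, mul_assoc]
    rw [h5, Real.logb_mul h4.ne']
    rw [h5] at hω
    exact (pos_of_mul_pos_right hω h4.le).ne'
  rw [h0, h1]
  linarith

/-! ### Packing and covering for the channel -/

/-- The first-slot exponents for a competitor with the correct quantization index. -/
def firstSame : Fin 3 → ℝ :=
  ![mutualInfo (joint1 ch d) (fun (x11, _, _, _, _) => x11) (fun (_, x21, _, y11, q) => (x21, y11, q)),
    mutualInfo (joint1 ch d) (fun (_, x21, _, _, _) => x21) (fun (x11, _, _, y11, q) => (x11, y11, q)),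
    mutualInfo (joint1 ch d) (fun (x11, x21, _, _, _) => (x11, x21)) (fun (_, _, _, y11, q) => (y11, q))]

/-- `I(Y_R; Ŷ_R)`. -/
def quantInfo : ℝ :=
  mutualInfo (joint1 ch d) (fun (_, _, yR, _, _) => yR) (fun (_, _, _, _, q) => q)

/-- The first-slot exponents for a competitor with a wrong quantization index. -/
def firstDiff : Fin 3 → ℝ :=
  ![mutualInfo (joint1 ch d) (fun (x11, _, _, _, _) => x11) (fun (_, x21, _, y11, _) => (x21, y11))
      - condMutualInfo (joint1 ch d) (fun (_, _, _, _, q) => q) (fun (_, _, yR, _, _) => yR)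
        (fun (x11, x21, _, y11, _) => (x11, x21, y11)) + quantInfo ch d,
    mutualInfo (joint1 ch d) (fun (_, x21, _, _, _) => x21) (fun (x11, _, _, y11, _) => (x11, y11))
      - condMutualInfo (joint1 ch d) (fun (_, _, _, _, q) => q) (fun (_, _, yR, _, _) => yR)
        (fun (x11, x21, _, y11, _) => (x21, x11, y11)) + quantInfo ch d,
    mutualInfo (joint1 ch d) (fun (x11, x21, _, _, q) => (x11, x21, q)) (fun (_, _, _, y11, _) => y11)
      + mutualInfo (joint1 ch d) (fun (x11, x21, _, _, _) => (x11, x21)) (fun (_, _, _, _, q) => q)]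

/-- The second-slot exponents for a competitor with the correct quantization index. -/
def secondSame : Fin 3 → ℝ :=
  ![mutualInfo (joint2 ch d) (fun (x12, _, _, _) => x12) (fun (_, x22, xR, y12) => (x22, xR, y12)),
    mutualInfo (joint2 ch d) (fun (_, x22, _, _) => x22) (fun (x12, _, xR, y12) => (x12, xR, y12)),
    mutualInfo (joint2 ch d) (fun (x12, x22, _, _) => (x12, x22)) (fun (_, _, xR, y12) => (xR, y12))]

/-- The second-slot exponents for a competitor with a wrong quantization index. -/
def secondDiff : Fin 3 → ℝ :=
  ![mutualInfo (joint2 ch d) (fun (x12, _, xR, _) => (x12, xR)) (fun (_, x22, _, y12) => (x22, y12)),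
    mutualInfo (joint2 ch d) (fun (_, x22, xR, _) => (x22, xR)) (fun (x12, _, _, y12) => (x12, y12)),
    mutualInfo (joint2 ch d) (fun (x12, x22, xR, _) => (x12, x22, xR)) (fun (_, _, _, y12) => y12)]

lemma expect_logb_joinPmf {Ω α β : Type*} [Fintype Ω] [Fintype α] [Fintype β] {p : Ω → ℝ}
    (hp : ∀ ω, 0 ≤ p ω) {f : Ω → α} {g : Ω → β} {P : α → ℝ} {Q : β → ℝ} (hf : ∀ a, law p f a = P a)
    (hg : ∀ b, law p g b = Q b) :
    expect p (fun ω => Real.logb 2 (joinPmf P (fun _ => Q) (f ω, g ω))) =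
      -entropy p f - entropy p g := by
  rw [← entropy_eq_of_law hf, sub_eq_add_neg, ← entropy_eq_of_law hg, ← expect_add]
  refine expect_congr_of_pos hp fun ω hω => ?_
  have h1 := law_pos hp f hω
  have h2 := law_pos hp g hω
  rw [hf] at h1
  rw [hg] at h2
  exact Real.logb_mul h1.ne' h2.ne'

lemma joinPmf_pos_of_law {Ω α β : Type*} [Fintype Ω] {p : Ω → ℝ}
    (hp : ∀ ω, 0 ≤ p ω) {f : Ω → α} {g : Ω → β} {P : α → ℝ} {Q : β → ℝ} (hf : ∀ a, law p f a = P a)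
    (hg : ∀ b, law p g b = Q b) {ω : Ω} (hω : 0 < p ω) :
    0 < joinPmf P (fun _ => Q) (f ω, g ω) := by
  have h1 := law_pos hp f hω
  have h2 := law_pos hp g hω
  rw [hf] at h1
  rw [hg] at h2
  exact mul_pos h1 h2

/-- In each use of `eventually_expect_typical_le`, α collects the fresh letters, β the given ones,
and ψ restores the order of the test. For a wrong index the quantization letter joins α under a
product law, so the exponent is the sum of the entropies of Ŷ_R, of the fresh source letters and of
the given letters, minus the joint entropy. -/
lemma eventually_packingBound_first :
    ∀ᶠ K : ℝ in atTop, ∀ (n : ℕ) (ε : ℝ), 0 ≤ ε →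
      PackingBound (prodPmf fun _ : Fin n => d.p11) (prodPmf fun _ : Fin n => d.p21)
        (prodPmf fun _ : Fin n => quantLaw ch d) (FirstTest ch d ε)
        (fun i => (2 : ℝ) ^ (-(n * (firstSame ch d i - ε * K))))
        (fun i => (2 : ℝ) ^ (-(n * (firstDiff ch d i - ε * K)))) := by
  have hp := joint1_mem ch d
  have hQ : ∀ a, law (joint1 ch d) (fun (_, _, _, _, q) => q) a = quantLaw ch d a := fun _ => rfl
  have e1 : entropy (joint1 ch d) (fun (x11, x21, yR, y11, q) => (q, yR, x21, x11, y11)) =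
      entropy (joint1 ch d) (fun (x11, x21, yR, y11, q) => (q, yR, x11, x21, y11)) :=
    entropy_congr _ fun ω ω' => by simp only [Prod.ext_iff]; tauto
  have e2 : entropy (joint1 ch d) (fun (x11, x21, yR, y11, _) => (yR, x21, x11, y11)) =
      entropy (joint1 ch d) (fun (x11, x21, yR, y11, _) => (yR, x11, x21, y11)) :=
    entropy_congr _ fun ω ω' => by simp only [Prod.ext_iff]; tauto
  have e3 : entropy (joint1 ch d) (fun (x11, x21, _, y11, q) => (q, x11, x21, y11)) =
      entropy (joint1 ch d) (fun (x11, x21, _, y11, q) => ((q, x11), x21, y11)) :=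
    entropy_congr _ fun ω ω' => by simp only [Prod.ext_iff]; tauto
  have e4 : entropy (joint1 ch d) (fun (x11, x21, _, y11, q) => (q, x21, x11, y11)) =
      entropy (joint1 ch d) (fun (x11, x21, _, y11, q) => ((q, x21), x11, y11)) :=
    entropy_congr _ fun ω ω' => by simp only [Prod.ext_iff]; tauto
  have e5 : entropy (joint1 ch d) (fun (x11, x21, _, y11, q) => ((x11, x21, q), y11)) =
      entropy (joint1 ch d) (fun (x11, x21, _, y11, q) => ((q, x11, x21), y11)) :=
    entropy_congr _ fun ω ω' => by simp only [Prod.ext_iff]; tauto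
  have e6 : entropy (joint1 ch d) (fun (x11, x21, _, _, q) => ((x11, x21), q)) =
      entropy (joint1 ch d) (fun (x11, x21, _, _, q) => (x11, x21, q)) :=
    entropy_congr _ fun ω ω' => by simp only [Prod.ext_iff]; tauto
  -- Needed for the single-source exponents with a wrong index, where the conditional mutual
  -- information occurs.
  have e7 := entropy_joint1 ch d
  filter_upwards [
    eventually_expect_typical_le hp (fun (x11, _, _, _, _) => x11)
      (fun (_, x21, _, y11, q) => (x21, y11, q)) (Q := d.p11)
      (fun ω hω => (law_joint1_x11 ch d _) ▸ law_pos hp.1 (fun ω => ω.1) hω)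
      (F := fun (x11, x21, _, y11, q) => (x11, x21, y11, q))
      (ψ := fun a b => (a, b.1, b.2.1, b.2.2)) (D := firstSame ch d 0)
      (fun _ _ _ _ h => by simp only [Prod.ext_iff] at h ⊢; tauto) (fun _ => rfl)
      (by
        have := entropy_eq_of_law (law_joint1_x11 ch d)
        simp only [firstSame, mutualInfo, Matrix.cons_val]
        linarith),
    eventually_expect_typical_le hp (fun (_, x21, _, _, _) => x21)
      (fun (x11, _, _, y11, q) => (x11, y11, q)) (Q := d.p21)
      (fun ω hω => (law_joint1_x21 ch d _) ▸ law_pos hp.1 (fun ω => ω.2.1) hω)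
      (F := fun (x11, x21, _, y11, q) => (x11, x21, y11, q))
      (ψ := fun a b => (b.1, a, b.2.1, b.2.2)) (D := firstSame ch d 1)
      (fun _ _ _ _ h => by simp only [Prod.ext_iff] at h ⊢; tauto) (fun _ => rfl)
      (by
        have := entropy_eq_of_law (law_joint1_x21 ch d)
        simp only [firstSame, mutualInfo, Matrix.cons_val]
        linarith),
    eventually_expect_typical_le hp (fun (x11, x21, _, _, _) => (x11, x21))
      (fun (_, _, _, y11, q) => (y11, q)) (Q := joinPmf d.p11 fun _ => d.p21)
      (fun ω hω => (law_joint1_x11_x21 ch d _) ▸ law_pos hp.1 (fun ω => (ω.1, ω.2.1)) hω)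
      (F := fun (x11, x21, _, y11, q) => (x11, x21, y11, q))
      (ψ := fun a b => (a.1, a.2, b.1, b.2)) (D := firstSame ch d 2)
      (fun _ _ _ _ h => by simp only [Prod.ext_iff] at h ⊢; tauto) (fun _ => rfl)
      (by
        have := entropy_eq_of_law (law_joint1_x11_x21 ch d)
        simp only [firstSame, mutualInfo, Matrix.cons_val]
        linarith),
    eventually_expect_typical_le hp (fun (x11, _, _, _, q) => (q, x11))
      (fun (_, x21, _, y11, _) => (x21, y11)) (Q := joinPmf (quantLaw ch d) fun _ => d.p11)
      (fun ω hω => joinPmf_pos_of_law hp.1 hQ (law_joint1_x11 ch d) hω)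
      (F := fun (x11, x21, _, y11, q) => (x11, x21, y11, q))
      (ψ := fun a b => (a.2, b.1, b.2, a.1)) (D := firstDiff ch d 0)
      (fun _ _ _ _ h => by simp only [Prod.ext_iff] at h ⊢; tauto) (fun _ => rfl)
      (by
        have := expect_logb_joinPmf hp.1 hQ (law_joint1_x11 ch d)
        simp only [firstDiff, quantInfo, mutualInfo, condMutualInfo, Matrix.cons_val]
        linarith),
    eventually_expect_typical_le hp (fun (_, x21, _, _, q) => (q, x21))
      (fun (x11, _, _, y11, _) => (x11, y11)) (Q := joinPmf (quantLaw ch d) fun _ => d.p21)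
      (fun ω hω => joinPmf_pos_of_law hp.1 hQ (law_joint1_x21 ch d) hω)
      (F := fun (x11, x21, _, y11, q) => (x11, x21, y11, q))
      (ψ := fun a b => (b.1, a.2, b.2, a.1)) (D := firstDiff ch d 1)
      (fun _ _ _ _ h => by simp only [Prod.ext_iff] at h ⊢; tauto) (fun _ => rfl)
      (by
        have := expect_logb_joinPmf hp.1 hQ (law_joint1_x21 ch d)
        simp only [firstDiff, quantInfo, mutualInfo, condMutualInfo, Matrix.cons_val]
        linarith),
    eventually_expect_typical_le hp (fun (x11, x21, _, _, q) => (q, x11, x21))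
      (fun (_, _, _, y11, _) => y11)
      (Q := joinPmf (quantLaw ch d) fun _ => joinPmf d.p11 fun _ => d.p21)
      (fun ω hω => joinPmf_pos_of_law hp.1 hQ (law_joint1_x11_x21 ch d) hω)
      (F := fun (x11, x21, _, y11, q) => (x11, x21, y11, q))
      (ψ := fun a b => (a.2.1, a.2.2, b, a.1)) (D := firstDiff ch d 2)
      (fun _ _ _ _ h => by simp only [Prod.ext_iff] at h ⊢; tauto) (fun _ => rfl)
      (by
        have := expect_logb_joinPmf hp.1 hQ (law_joint1_x11_x21 ch d)
        simp only [firstDiff, mutualInfo, Matrix.cons_val]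
        linarith)] with K k1 k2 k3 k4 k5 k6 n ε hε
  refine ⟨fun x' y q => k1 n (fun i => (x' i, y i, q i)) ε hε,
    fun x y q => k2 n (fun i => (x i, y i, q i)) ε hε,
    fun y q => le_trans (le_of_eq ?_) (k3 n (fun i => (y i, q i)) ε hε),
    fun x' y => le_trans (le_of_eq ?_) (k4 n (fun i => (x' i, y i)) ε hε),
    fun x y => le_trans (le_of_eq ?_) (k5 n (fun i => (x i, y i)) ε hε),
    fun y => le_trans (le_of_eq ?_) (k6 n y ε hε)⟩
  · rw [expect_joinPmf]
    exact (expect_prodPmf_joinPmf (fun _ : Fin n => d.p11) (fun _ _ => d.p21)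
      (fun x x' => ind (FirstTest ch d ε (x, x') y q))).symm
  · exact (expect_prodPmf_joinPmf (fun _ : Fin n => quantLaw ch d) (fun _ _ => d.p11)
      (fun q x => ind (FirstTest ch d ε (x, x') y q))).symm
  · exact (expect_prodPmf_joinPmf (fun _ : Fin n => quantLaw ch d) (fun _ _ => d.p21)
      (fun q x' => ind (FirstTest ch d ε (x, x') y q))).symm
  · simp only [expect_joinPmf]
    simp only [fun q => (expect_prodPmf_joinPmf (fun _ : Fin n => d.p11) (fun _ _ => d.p21)
      (fun x x' => ind (FirstTest ch d ε (x, x') y q))).symm]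
    exact (expect_prodPmf_joinPmf (fun _ : Fin n => quantLaw ch d)
      (fun _ _ => joinPmf d.p11 fun _ => d.p21)
      (fun q z => ind (FirstTest ch d ε (fun i => (z i).1, fun i => (z i).2) y q))).symm

/-- The inputs of the sources and the relay are independent, so the fresh letters already have their
true joint law and every exponent is a plain mutual information. -/
lemma eventually_packingBound_second :
    ∀ᶠ K : ℝ in atTop, ∀ (m : ℕ) (ε : ℝ), 0 ≤ ε →
      PackingBound (prodPmf fun _ : Fin m => d.p12) (prodPmf fun _ : Fin m => d.p22)
        (prodPmf fun _ : Fin m => d.pR) (SecondTest ch d ε)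
        (fun i => (2 : ℝ) ^ (-(m * (secondSame ch d i - ε * K))))
        (fun i => (2 : ℝ) ^ (-(m * (secondDiff ch d i - ε * K)))) := by
  have hp := joint2_mem ch d
  have hl : law (joint2 ch d) (fun ω => ω) = joint2 ch d := funext fun a => by
    rw [law_eq_expect, expect_ind_eq]
  have e1 : entropy (joint2 ch d) (fun (x12, _, xR, _) => (x12, xR)) =
      entropy (joint2 ch d) (fun (x12, _, xR, _) => (xR, x12)) :=
    entropy_congr _ fun ω ω' => by simp only [Prod.ext_iff]; tauto
  have e2 : entropy (joint2 ch d) (fun (_, x22, xR, _) => (x22, xR)) =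
      entropy (joint2 ch d) (fun (_, x22, xR, _) => (xR, x22)) :=
    entropy_congr _ fun ω ω' => by simp only [Prod.ext_iff]; tauto
  have e3 : entropy (joint2 ch d) (fun (x12, x22, xR, _) => (x12, x22, xR)) =
      entropy (joint2 ch d) (fun (x12, x22, xR, _) => (xR, x12, x22)) :=
    entropy_congr _ fun ω ω' => by simp only [Prod.ext_iff]; tauto
  have e4 : entropy (joint2 ch d) (fun (x12, x22, xR, y12) => ((x12, xR), x22, y12)) =
      entropy (joint2 ch d) (fun (x12, x22, xR, y12) => ((xR, x12), x22, y12)) :=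
    entropy_congr _ fun ω ω' => by simp only [Prod.ext_iff]; tauto
  have e5 : entropy (joint2 ch d) (fun (x12, x22, xR, y12) => ((x22, xR), x12, y12)) =
      entropy (joint2 ch d) (fun (x12, x22, xR, y12) => ((xR, x22), x12, y12)) :=
    entropy_congr _ fun ω ω' => by simp only [Prod.ext_iff]; tauto
  have e6 : entropy (joint2 ch d) (fun (x12, x22, xR, y12) => ((x12, x22, xR), y12)) =
      entropy (joint2 ch d) (fun (x12, x22, xR, y12) => ((xR, x12, x22), y12)) :=
    entropy_congr _ fun ω ω' => by simp only [Prod.ext_iff]; tauto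
  filter_upwards [
    eventually_expect_typical_le hp (fun (x12, _, _, _) => x12)
      (fun (_, x22, xR, y12) => (x22, xR, y12)) (Q := d.p12)
      (fun ω hω => (law_joint2_x12 ch d _) ▸ law_pos hp.1 (fun ω => ω.1) hω)
      (F := fun ω => ω) (ψ := fun a b => (a, b.1, b.2.1, b.2.2)) (D := secondSame ch d 0)
      (fun _ _ _ _ h => by simp only [Prod.ext_iff] at h ⊢; tauto) (fun _ => rfl)
      (by
        have := entropy_eq_of_law (law_joint2_x12 ch d)
        simp only [secondSame, mutualInfo, Matrix.cons_val]
        linarith),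
    eventually_expect_typical_le hp (fun (_, x22, _, _) => x22)
      (fun (x12, _, xR, y12) => (x12, xR, y12)) (Q := d.p22)
      (fun ω hω => (law_joint2_x22 ch d _) ▸ law_pos hp.1 (fun ω => ω.2.1) hω)
      (F := fun ω => ω) (ψ := fun a b => (b.1, a, b.2.1, b.2.2)) (D := secondSame ch d 1)
      (fun _ _ _ _ h => by simp only [Prod.ext_iff] at h ⊢; tauto) (fun _ => rfl)
      (by
        have := entropy_eq_of_law (law_joint2_x22 ch d)
        simp only [secondSame, mutualInfo, Matrix.cons_val]
        linarith),
    eventually_expect_typical_le hp (fun (x12, x22, _, _) => (x12, x22))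
      (fun (_, _, xR, y12) => (xR, y12)) (Q := joinPmf d.p12 fun _ => d.p22)
      (fun ω hω => (law_joint2_x12_x22 ch d _) ▸ law_pos hp.1 (fun ω => (ω.1, ω.2.1)) hω)
      (F := fun ω => ω) (ψ := fun a b => (a.1, a.2, b.1, b.2)) (D := secondSame ch d 2)
      (fun _ _ _ _ h => by simp only [Prod.ext_iff] at h ⊢; tauto) (fun _ => rfl)
      (by
        have := entropy_eq_of_law (law_joint2_x12_x22 ch d)
        simp only [secondSame, mutualInfo, Matrix.cons_val]
        linarith),
    eventually_expect_typical_le hp (fun (x12, _, xR, _) => (xR, x12))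
      (fun (_, x22, _, y12) => (x22, y12)) (Q := joinPmf d.pR fun _ => d.p12)
      (fun ω hω => (law_joint2_xR_x12 ch d _) ▸ law_pos hp.1 (fun ω => (ω.2.2.1, ω.1)) hω)
      (F := fun ω => ω) (ψ := fun a b => (a.2, b.1, a.1, b.2)) (D := secondDiff ch d 0)
      (fun _ _ _ _ h => by simp only [Prod.ext_iff] at h ⊢; tauto) (fun _ => rfl)
      (by
        have := entropy_eq_of_law (law_joint2_xR_x12 ch d)
        simp only [secondDiff, mutualInfo, Matrix.cons_val]
        linarith),
    eventually_expect_typical_le hp (fun (_, x22, xR, _) => (xR, x22))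
      (fun (x12, _, _, y12) => (x12, y12)) (Q := joinPmf d.pR fun _ => d.p22)
      (fun ω hω => (law_joint2_xR_x22 ch d _) ▸ law_pos hp.1 (fun ω => (ω.2.2.1, ω.2.1)) hω)
      (F := fun ω => ω) (ψ := fun a b => (b.1, a.2, a.1, b.2)) (D := secondDiff ch d 1)
      (fun _ _ _ _ h => by simp only [Prod.ext_iff] at h ⊢; tauto) (fun _ => rfl)
      (by
        have := entropy_eq_of_law (law_joint2_xR_x22 ch d)
        simp only [secondDiff, mutualInfo, Matrix.cons_val]
        linarith),
    eventually_expect_typical_le hp (fun (x12, x22, xR, _) => (xR, x12, x22))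
      (fun (_, _, _, y12) => y12) (Q := joinPmf d.pR fun _ => joinPmf d.p12 fun _ => d.p22)
      (fun ω hω => (law_joint2_xR_x12_x22 ch d _) ▸
        law_pos hp.1 (fun ω => (ω.2.2.1, ω.1, ω.2.1)) hω)
      (F := fun ω => ω) (ψ := fun a b => (a.2.1, a.2.2, a.1, b)) (D := secondDiff ch d 2)
      (fun _ _ _ _ h => by simp only [Prod.ext_iff] at h ⊢; tauto) (fun _ => rfl)
      (by
        have := entropy_eq_of_law (law_joint2_xR_x12_x22 ch d)
        simp only [secondDiff, mutualInfo, Matrix.cons_val]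
        linarith)] with K k1 k2 k3 k4 k5 k6 m ε hε
  rw [hl] at k1 k2 k3 k4 k5 k6
  refine ⟨fun x' y x => k1 m (fun i => (x' i, x i, y i)) ε hε,
    fun x' y x => k2 m (fun i => (x' i, x i, y i)) ε hε,
    fun y x => le_trans (le_of_eq ?_) (k3 m (fun i => (x i, y i)) ε hε),
    fun x' y => le_trans (le_of_eq ?_) (k4 m (fun i => (x' i, y i)) ε hε),
    fun x y => le_trans (le_of_eq ?_) (k5 m (fun i => (x i, y i)) ε hε),
    fun y => le_trans (le_of_eq ?_) (k6 m y ε hε)⟩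
  · rw [expect_joinPmf]
    exact (expect_prodPmf_joinPmf (fun _ : Fin m => d.p12) (fun _ _ => d.p22)
      (fun z z' => ind (SecondTest ch d ε (z, z') y x))).symm
  · exact (expect_prodPmf_joinPmf (fun _ : Fin m => d.pR) (fun _ _ => d.p12)
      (fun q x => ind (SecondTest ch d ε (x, x') y q))).symm
  · exact (expect_prodPmf_joinPmf (fun _ : Fin m => d.pR) (fun _ _ => d.p22)
      (fun q x' => ind (SecondTest ch d ε (x, x') y q))).symm
  · simp only [expect_joinPmf]
    simp only [fun q => (expect_prodPmf_joinPmf (fun _ : Fin m => d.p12) (fun _ _ => d.p22)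
      (fun x x' => ind (SecondTest ch d ε (x, x') y q))).symm]
    exact (expect_prodPmf_joinPmf (fun _ : Fin m => d.pR)
      (fun _ _ => joinPmf d.p12 fun _ => d.p22)
      (fun q z => ind (SecondTest ch d ε (fun i => (z i).1, fun i => (z i).2) y q))).symm

lemma quantLaw_pos (z : YR × YQ) (hz : 0 < joinPmf (relayLaw ch d) d.quant z) :
    0 < quantLaw ch d z.2 := by
  rw [← law_relay_quant] at hz
  obtain ⟨ω, hω, rfl⟩ := exists_pos_of_law_pos (joint1_mem ch d).1 hz
  exact law_pos (joint1_mem ch d).1 (fun ω => ω.2.2.2.2) hω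

lemma relayLaw_mem : relayLaw ch d ∈ stdSimplex ℝ YR := law_mem (slotOneLaw_mem ch d) _

lemma quantLaw_mem : quantLaw ch d ∈ stdSimplex ℝ YQ := law_mem (joint1_mem ch d) _

lemma quantInfo_eq : quantInfo ch d = expect (joinPmf (relayLaw ch d) d.quant)
    (fun z => Real.logb 2 (d.quant z.1 z.2) - Real.logb 2 (quantLaw ch d z.2)) := by
  rw [← law_relay_quant, expect_law, expect_sub, expect_logb_quant]
  have := entropy_eq_of_law (p := joint1 ch d) (f := fun (_, _, _, _, q) => q) fun _ => rfl
  simp only [quantInfo, mutualInfo, quantLaw]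
  linarith

lemma quantInfo_nonneg : 0 ≤ quantInfo ch d := by
  rw [quantInfo_eq]
  exact expect_logb_sub_nonneg (relayLaw_mem ch d) d.quant_mem (quantLaw_mem ch d)
    (quantLaw_pos ch d)

/-- Only the marginal of y_R^n matters; the other first-slot letters are integrated out. -/
lemma eventually_covering_le :
    ∀ᶠ K : ℝ in atTop, ∀ (n MU : ℕ) (ε : ℝ), 0 < n → 0 < ε →
      expect (joinPmf (prodPmf fun _ : Fin n => d.p11) fun _ => prodPmf fun _ : Fin n => d.p21)
        (fun s => expect (ch.firstSlot s) fun y => (1 - expect (prodPmf fun _ : Fin n => quantLaw ch d)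
          (fun q => ind (RelayTest ch d ε y.1 q))) ^ MU) ≤
        (∑ z, 1 / (ε * joinPmf (relayLaw ch d) d.quant z) ^ 2) / n
          + Real.exp (-(MU * (2 : ℝ) ^ (-(n * (quantInfo ch d + ε * K))))) := by
  have hr := slotOneLaw_mem ch d
  filter_upwards [eventually_expect_covering_le (relayLaw_mem ch d) d.quant_mem (quantLaw_mem ch d)
    (quantLaw_pos ch d) (quantInfo_eq ch d)] with K hK n MU ε hn hε
  refine le_trans (le_of_eq ?_) (hK n MU ε hn hε)
  refine (expect_firstSlot_eq ch d fun _ _ yR _ =>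
    (1 - expect (prodPmf fun _ : Fin n => quantLaw ch d)
      (fun q => ind (RelayTest ch d ε yR q))) ^ MU).trans ?_
  rw [expect_prodPmf_eq_expect_law hr.1 (fun (_, _, yR, _) => yR) (fun yR _ =>
    (1 - expect (prodPmf fun _ : Fin n => quantLaw ch d)
      (fun q => ind (RelayTest ch d ε yR q))) ^ MU)]
  simp only [fun yR : Fin n → YR => expect_const (prodPmf_mem fun i =>
    condPmf_mem hr (fun (_, _, yR, _) => yR) (yR i)), RelayTest, law_relay_quant]
  rfl

end Rates

/-! ### Rates -/

lemma rpow_le_numMessages (l : ℕ) (R : ℝ) : (2 : ℝ) ^ ((l : ℝ) * R) ≤ numMessages l R :=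
  Nat.le_ceil _

lemma numMessages_pos (l : ℕ) (R : ℝ) : 0 < numMessages l R :=
  Nat.ceil_pos.2 (by positivity)

/-- R ≥ 0 makes the power at least 1, so rounding up costs at most a factor 2. -/
lemma numMessages_le (l : ℕ) {R : ℝ} (hR : 0 ≤ R) :
    (numMessages l R : ℝ) ≤ 2 * (2 : ℝ) ^ ((l : ℝ) * R) := by
  have h1 := Nat.ceil_lt_add_one (show (0 : ℝ) ≤ (2 : ℝ) ^ ((l : ℝ) * R) by positivity)
  have h2 : (1 : ℝ) ≤ (2 : ℝ) ^ ((l : ℝ) * R) :=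
    Real.one_le_rpow one_le_two (by positivity)
  unfold numMessages
  linarith

/-! ### Limits along growing block lengths -/

section Asymptotics

variable {n m : ℕ → ℕ} {β : ℝ}

/-- The expression is l times R - (n/l) X - (1 - n/l) Y, whose limit is negative. Special values of
R, X, Y also give the covering exponent and the growth of each slot. -/
lemma tendsto_exponent_atBot (hl : Tendsto (fun k => n k + m k) atTop atTop)
    (hβ : Tendsto (fun k => (n k : ℝ) / ((n k + m k : ℕ) : ℝ)) atTop (𝓝 β))
    {R X Y : ℝ} (h : R < β * X + (1 - β) * Y) :
    Tendsto (fun k => ((n k + m k : ℕ) : ℝ) * R - n k * X - m k * Y) atTop atBot := by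
  have hl' : Tendsto (fun k => ((n k + m k : ℕ) : ℝ)) atTop atTop :=
    tendsto_natCast_atTop_atTop.comp hl
  have h1 : Tendsto (fun k => R - (n k : ℝ) / ((n k + m k : ℕ) : ℝ) * X -
      (1 - (n k : ℝ) / ((n k + m k : ℕ) : ℝ)) * Y) atTop (𝓝 (R - β * X - (1 - β) * Y)) :=
    (tendsto_const_nhds.sub (hβ.mul_const X)).sub ((tendsto_const_nhds.sub hβ).mul_const Y)
  refine (hl'.atTop_mul_neg (by linarith) h1).congr' ?_
  filter_upwards [hl'.eventually_gt_atTop 0] with k hk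
  have : ((n k + m k : ℕ) : ℝ) = n k + m k := by push_cast; ring
  field_simp
  rw [this]
  ring

lemma tendsto_count_mul_rpow (hl : Tendsto (fun k => n k + m k) atTop atTop)
    (hβ : Tendsto (fun k => (n k : ℝ) / ((n k + m k : ℕ) : ℝ)) atTop (𝓝 β))
    {N : ℕ → ℝ} {c R X Y : ℝ} (hN0 : ∀ k, 0 ≤ N k)
    (hN : ∀ k, N k ≤ c * (2 : ℝ) ^ (((n k + m k : ℕ) : ℝ) * R)) (h : R < β * X + (1 - β) * Y) :
    Tendsto (fun k => N k * ((2 : ℝ) ^ (-(n k * X)) * (2 : ℝ) ^ (-(m k * Y)))) atTop (𝓝 0) := by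
  have h1 := ((tendsto_rpow_atBot_of_base_gt_one 2 one_lt_two).comp
    (tendsto_exponent_atBot hl hβ h)).const_mul c
  rw [mul_zero] at h1
  refine squeeze_zero (fun k => mul_nonneg (hN0 k) (by positivity)) (fun k => ?_) h1
  refine (mul_le_mul_of_nonneg_right (hN k) (by positivity)).trans_eq ?_
  rw [mul_assoc, ← Real.rpow_add two_pos, ← Real.rpow_add two_pos]
  simp only [Function.comp]
  ring_nf

lemma tendsto_exp_covering (hl : Tendsto (fun k => n k + m k) atTop atTop)
    (hβ : Tendsto (fun k => (n k : ℝ) / ((n k + m k : ℕ) : ℝ)) atTop (𝓝 β))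
    {RU X : ℝ} (h : β * X < RU) :
    Tendsto (fun k => Real.exp (-(numMessages (n k + m k) RU * (2 : ℝ) ^ (-(n k * X)))))
      atTop (𝓝 0) := by
  have h1 := tendsto_neg_atBot_atTop.comp
    (tendsto_exponent_atBot hl hβ (R := -RU) (X := -X) (Y := 0) (by linarith))
  have h2 := (tendsto_rpow_atTop_of_base_gt_one 2 one_lt_two).comp h1
  refine Real.tendsto_exp_neg_atTop_nhds_zero.comp (tendsto_atTop_mono (fun k => ?_) h2)
  calc _ = (2 : ℝ) ^ (((n k + m k : ℕ) : ℝ) * RU) * (2 : ℝ) ^ (-(n k * X)) := by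
        rw [← Real.rpow_add two_pos]
        simp only [Function.comp]
        ring_nf
    _ ≤ _ := mul_le_mul_of_nonneg_right (rpow_le_numMessages _ _) (by positivity)

lemma tendsto_fst_slot (hl : Tendsto (fun k => n k + m k) atTop atTop)
    (hβ : Tendsto (fun k => (n k : ℝ) / ((n k + m k : ℕ) : ℝ)) atTop (𝓝 β))
    (h0 : 0 < β) : Tendsto (fun k => (n k : ℝ)) atTop atTop := by
  refine (tendsto_neg_atBot_atTop.comp (tendsto_exponent_atBot hl hβ (R := 0) (X := 1) (Y := 0)
    (by linarith))).congr fun k => ?_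
  simp

lemma tendsto_snd_slot (hl : Tendsto (fun k => n k + m k) atTop atTop)
    (hβ : Tendsto (fun k => (n k : ℝ) / ((n k + m k : ℕ) : ℝ)) atTop (𝓝 β))
    (h1 : β < 1) : Tendsto (fun k => (m k : ℝ)) atTop atTop := by
  refine (tendsto_neg_atBot_atTop.comp (tendsto_exponent_atBot hl hβ (R := 0) (X := 0) (Y := 1)
    (by linarith))).congr fun k => ?_
  simp

end Asymptotics

/-! ### Choice of the parameters and conclusion -/

section Achievability

lemma Code.errorProb_nonneg {X11 X21 X12 X22 XR YR Y11 Y12 : Type*}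
    [Fintype YR] [Fintype Y11] [Fintype Y12] (ch : Channel X11 X21 X12 X22 XR YR Y11 Y12) {n m M1 M2 : ℕ}
    (C : Code X11 X21 X12 X22 XR YR Y11 Y12 n m M1 M2) : 0 ≤ C.errorProb ch := by
  refine mul_nonneg (by positivity) (Finset.sum_nonneg fun w1 _ => Finset.sum_nonneg fun w2 _ =>
    Finset.sum_nonneg fun yR _ => Finset.sum_nonneg fun y11 _ => Finset.sum_nonneg fun y12 _ =>
      mul_nonneg (mul_nonneg (Finset.prod_nonneg fun i _ => (ch.slot1_mem _ _).1 _)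
        (Finset.prod_nonneg fun i _ => (ch.slot2_mem _ _ _).1 _)) ?_)
  split_ifs <;> norm_num

variable {X11 X21 X12 X22 XR YR Y11 Y12 YQ : Type*}
  [Fintype X11] [Fintype X21] [Fintype X12] [Fintype X22] [Fintype XR]
  [Fintype YR] [Fintype Y11] [Fintype Y12] [Fintype YQ]

variable (ch : Channel X11 X21 X12 X22 XR YR Y11 Y12) (d : InputDist X11 X21 X12 X22 XR YR YQ)

/-- A GQF code is demanded for every k, including blocks with an empty slot, where the error
estimates do not apply. -/
lemma exists_isGQF {ε' ε : ℝ} {n m M1 M2 MU : ℕ} (hM1 : 0 < M1) (hM2 : 0 < M2) (hMU : 0 < MU) :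
    ∃ C : Code X11 X21 X12 X22 XR YR Y11 Y12 n m M1 M2, C.IsGQF ch d ε' ε MU := by
  obtain ⟨C, hC, -⟩ := exists_isGQF_errorProb_le ch d (ε' := ε') (ε := ε) (n := n) (m := m) hM1 hM2
    hMU (quantLaw_mem ch d) (e := 1) fun w =>
      expect_le (codebooks_mem (prodPmf_mem fun _ => d.p11_mem) (prodPmf_mem fun _ => d.p21_mem))
        fun _ => expect_le (prodPmf_mem fun _ => prodPmf_mem fun _ => quantLaw_mem ch d) fun _ =>
        expect_le (codebooks_mem (prodPmf_mem fun _ => d.p12_mem) (prodPmf_mem fun _ => d.p22_mem))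
        fun _ => expect_le (prodPmf_mem fun _ => prodPmf_mem fun _ => d.pR_mem) fun _ =>
        expect_le (firstSlot_mem ch _) fun _ => expect_le (secondSlot_mem ch _ _) fun _ =>
          ind_le_one _
  exact ⟨C, hC⟩

/-- Achievability in terms of the packing exponents of the two slots. -/
lemma achievableByGQF_of_exponents {β : ℝ} (hβ0 : 0 < β) (hβ1 : β < 1) {R1 R2 : ℝ} (hR1 : 0 ≤ R1)
    (hR2 : 0 ≤ R2)
    (hs : ∀ i, ![R1, R2, R1 + R2] i < β * firstSame ch d i + (1 - β) * secondSame ch d i)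
    (hd : ∀ i, ![R1, R2, R1 + R2] i + β * quantInfo ch d <
      β * firstDiff ch d i + (1 - β) * secondDiff ch d i) :
    AchievableByGQF ch d β R1 R2 := by
  set R : Fin 3 → ℝ := ![R1, R2, R1 + R2] with hR
  -- K is fixed before ε. The loss in each exponent is a multiple of εK, so a small ε then preserves
  -- all the strict inequalities.
  obtain ⟨K, hK1, hK2, hK3⟩ := ((eventually_packingBound_first ch d).and
    ((eventually_packingBound_second ch d).and (eventually_covering_le ch d))).exists
  -- R_U will exceed the covering threshold by δ, taken within the slack of the packing conditions
  -- for a wrong index.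
  obtain ⟨δ, hδ, hδ0⟩ : ∃ δ, (∀ i, R i + (β * quantInfo ch d + δ) <
      β * firstDiff ch d i + (1 - β) * secondDiff ch d i) ∧ 0 < δ := by
    refine Eventually.exists (f := 𝓝[>] (0 : ℝ)) ((eventually_all.2 fun i => ?_).and
      eventually_mem_nhdsWithin)
    have : Tendsto (fun δ => R i + (β * quantInfo ch d + δ)) (𝓝[>] (0 : ℝ))
        (𝓝 (R i + (β * quantInfo ch d + 0))) :=
      (Continuous.tendsto (by fun_prop) 0).mono_left nhdsWithin_le_nhds
    refine this.eventually_lt_const ?_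
    have := hd i
    linarith
  set RU := β * quantInfo ch d + δ with hRU
  have hRU0 : 0 ≤ RU := by
    have := quantInfo_nonneg ch d
    positivity
  obtain ⟨ε, ⟨hεs, hεd, hεc, hε1⟩, hε0⟩ : ∃ ε, ((∀ i, R i <
        β * (firstSame ch d i - ε * K) + (1 - β) * (secondSame ch d i - ε * K)) ∧
      (∀ i, R i + RU < β * (firstDiff ch d i - ε * K) + (1 - β) * (secondDiff ch d i - ε * K)) ∧
      β * (quantInfo ch d + ε / 2 * K) < RU ∧ ε < 1) ∧ 0 < ε := by
    refine Eventually.exists (f := 𝓝[>] (0 : ℝ)) (Eventually.and ?_ eventually_mem_nhdsWithin)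
    refine (Eventually.and ?_ (Eventually.and ?_ (Eventually.and ?_ ?_))).filter_mono
      nhdsWithin_le_nhds
    · refine eventually_all.2 fun i => ?_
      have : Tendsto (fun ε : ℝ => β * (firstSame ch d i - ε * K) +
          (1 - β) * (secondSame ch d i - ε * K)) (𝓝 0) (𝓝 (β * (firstSame ch d i - 0 * K) +
          (1 - β) * (secondSame ch d i - 0 * K))) := Continuous.tendsto (by fun_prop) 0
      refine this.eventually_const_lt ?_
      simpa using hs i
    · refine eventually_all.2 fun i => ?_
      have : Tendsto (fun ε : ℝ => β * (firstDiff ch d i - ε * K) +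
          (1 - β) * (secondDiff ch d i - ε * K)) (𝓝 0) (𝓝 (β * (firstDiff ch d i - 0 * K) +
          (1 - β) * (secondDiff ch d i - 0 * K))) := Continuous.tendsto (by fun_prop) 0
      refine this.eventually_const_lt ?_
      simpa using hδ i
    · have : Tendsto (fun ε : ℝ => β * (quantInfo ch d + ε / 2 * K)) (𝓝 0)
          (𝓝 (β * (quantInfo ch d + 0 / 2 * K))) := Continuous.tendsto (by fun_prop) 0
      refine this.eventually_lt_const ?_
      simp only [zero_div, zero_mul, add_zero]
      linarith
    · exact eventually_lt_nhds one_pos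
  refine ⟨RU, ε / 2, ε, hRU0, by positivity, by linarith, hε1, fun n m hl hβ => ?_⟩
  set M1 := fun k => numMessages (n k + m k) R1
  set M2 := fun k => numMessages (n k + m k) R2
  set MU := fun k => numMessages (n k + m k) RU
  set a₁ : ℕ → Fin 3 → ℝ := fun k i => (2 : ℝ) ^ (-(n k * (firstSame ch d i - ε * K)))
  set b₁ : ℕ → Fin 3 → ℝ := fun k i => (2 : ℝ) ^ (-(n k * (firstDiff ch d i - ε * K)))
  set a₂ : ℕ → Fin 3 → ℝ := fun k i => (2 : ℝ) ^ (-(m k * (secondSame ch d i - ε * K)))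
  set b₂ : ℕ → Fin 3 → ℝ := fun k i => (2 : ℝ) ^ (-(m k * (secondDiff ch d i - ε * K)))
  -- The Chebyshev constants do not depend on k; only their being fixed matters for the limit.
  obtain ⟨c₀, hc₀⟩ : ∃ c, c = ∑ z, 1 / (ε / 2 * joinPmf (relayLaw ch d) d.quant z) ^ 2 := ⟨_, rfl⟩
  obtain ⟨c₁, hc₁⟩ : ∃ c, c = ∑ a, 1 / ((ε - ε / 2) * law (joint1 ch d)
    (fun (x11, x21, _, y11, q) => (x11, x21, y11, q)) a) ^ 2 := ⟨_, rfl⟩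
  obtain ⟨c₂, hc₂⟩ : ∃ c, c = ∑ z, 1 / (ε * joint2 ch d z) ^ 2 := ⟨_, rfl⟩
  set e₀ : ℕ → ℝ := fun k => c₀ / n k +
    Real.exp (-(MU k * (2 : ℝ) ^ (-(n k * (quantInfo ch d + ε / 2 * K)))))
  set bound : ℕ → ℝ := fun k => e₀ k + c₁ / n k + c₂ / m k +
    (M1 k * (a₁ k 0 * a₂ k 0 + MU k * (b₁ k 0 * b₂ k 0)) +
      M2 k * (a₁ k 1 * a₂ k 1 + MU k * (b₁ k 1 * b₂ k 1)) +
      M1 k * M2 k * (a₁ k 2 * a₂ k 2 + MU k * (b₁ k 2 * b₂ k 2)))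
  have hcode : ∀ k, ∃ C : Code X11 X21 X12 X22 XR YR Y11 Y12 (n k) (m k) (M1 k) (M2 k),
      C.IsGQF ch d (ε / 2) ε (MU k) ∧ (0 < n k → 0 < m k → C.errorProb ch ≤ bound k) := by
    intro k
    have h1 := numMessages_pos (n k + m k) R1
    have h2 := numMessages_pos (n k + m k) R2
    have hU := numMessages_pos (n k + m k) RU
    by_cases hnm : 0 < n k ∧ 0 < m k
    · obtain ⟨C, hC, hCe⟩ := exists_isGQF_errorProb_le ch d h1 h2 hU (quantLaw_mem ch d)
        fun w => expect_failureProb_le ch d (ε' := ε / 2) (ε := ε) hU (quantLaw_mem ch d)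
          (hK3 (n k) (MU k) (ε / 2) hnm.1 (by positivity))
          (expect_relayTest_not_firstTest_le ch d (by linarith) hnm.1)
          (expect_not_secondTest_le ch d hε0 hnm.2)
          (fun i => by positivity) (fun i => by positivity) (fun i => by positivity)
          (fun i => by positivity) (hK1 (n k) ε (le_of_lt hε0)) (hK2 (m k) ε (le_of_lt hε0)) w
      refine ⟨C, hC, fun _ _ => hCe.trans_eq ?_⟩
      simp only [bound, e₀, hc₀, hc₁, hc₂, M1, M2, MU, a₁, a₂, b₁, b₂]
    · obtain ⟨C, hC⟩ := exists_isGQF ch d (ε' := ε / 2) (ε := ε) (n := n k) (m := m k) h1 h2 hU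
      exact ⟨C, hC, fun hn hm => absurd ⟨hn, hm⟩ hnm⟩
  have hn := tendsto_fst_slot hl hβ hβ0
  have hm := tendsto_snd_slot hl hβ hβ1
  have hM1 : ∀ k, (M1 k : ℝ) ≤ 2 * (2 : ℝ) ^ (((n k + m k : ℕ) : ℝ) * R1) :=
    fun k => numMessages_le _ hR1
  have hM2 : ∀ k, (M2 k : ℝ) ≤ 2 * (2 : ℝ) ^ (((n k + m k : ℕ) : ℝ) * R2) :=
    fun k => numMessages_le _ hR2
  have hMU : ∀ k, (MU k : ℝ) ≤ 2 * (2 : ℝ) ^ (((n k + m k : ℕ) : ℝ) * RU) :=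
    fun k => numMessages_le _ hRU0
  have hmul : ∀ {N N' : ℕ → ℝ} {c c' S S' : ℝ}, (∀ k, 0 ≤ N' k) → 0 ≤ c →
      (∀ k, N k ≤ c * (2 : ℝ) ^ (((n k + m k : ℕ) : ℝ) * S)) →
      (∀ k, N' k ≤ c' * (2 : ℝ) ^ (((n k + m k : ℕ) : ℝ) * S')) →
      ∀ k, N k * N' k ≤ (c * c') * (2 : ℝ) ^ (((n k + m k : ℕ) : ℝ) * (S + S')) := by
    intro N N' c c' S S' h0 hc h h' k
    refine (mul_le_mul (h k) (h' k) (h0 k) (by positivity)).trans_eq ?_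
    rw [mul_add, Real.rpow_add two_pos]
    ring
  have hM12 := hmul (fun k => Nat.cast_nonneg (M2 k)) zero_le_two hM1 hM2
  have hcount : ∀ {N : ℕ → ℝ} {c : ℝ} (i : Fin 3), (∀ k, 0 ≤ N k) → 0 ≤ c →
      (∀ k, N k ≤ c * (2 : ℝ) ^ (((n k + m k : ℕ) : ℝ) * R i)) →
      Tendsto (fun k => N k * (a₁ k i * a₂ k i + MU k * (b₁ k i * b₂ k i))) atTop (𝓝 0) := by
    intro N c i h0 hc h
    have t1 := tendsto_count_mul_rpow hl hβ h0 h (hεs i)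
    have t2 := tendsto_count_mul_rpow hl hβ (fun k => mul_nonneg (h0 k) (Nat.cast_nonneg (MU k)))
      (hmul (fun k => Nat.cast_nonneg (MU k)) hc h hMU) (hεd i)
    have t3 := t1.add t2
    rw [add_zero] at t3
    refine t3.congr fun k => ?_
    simp only [a₁, a₂, b₁, b₂]
    ring
  have hbound : Tendsto bound atTop (𝓝 0) := by
    have t0 := (hn.const_div_atTop c₀).add (tendsto_exp_covering hl hβ hεc)
    have t := ((t0.add (hn.const_div_atTop c₁)).add (hm.const_div_atTop c₂)).add
      (((hcount (N := fun k => M1 k) 0 (fun k => Nat.cast_nonneg _) zero_le_two hM1).add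
      (hcount (N := fun k => M2 k) 1 (fun k => Nat.cast_nonneg _) zero_le_two hM2)).add
      (hcount (N := fun k => M1 k * M2 k) 2 (fun k => by positivity) (by norm_num) hM12))
    simpa only [add_zero] using t
  choose C hC hCe using hcode
  refine ⟨C, hC, squeeze_zero' (Eventually.of_forall fun k => (C k).errorProb_nonneg ch) ?_ hbound⟩
  filter_upwards [hn.eventually_gt_atTop 0, hm.eventually_gt_atTop 0] with k hnk hmk
  exact hCe k (Nat.cast_pos.1 hnk) (Nat.cast_pos.1 hmk)

end Achievability

end HDMARC

end

theorem theorem1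
    {X11 X21 X12 X22 XR YR Y11 Y12 YQ : Type*}
    [Fintype X11] [Fintype X21] [Fintype X12] [Fintype X22] [Fintype XR]
    [Fintype YR] [Fintype Y11] [Fintype Y12] [Fintype YQ]
    (ch : HDMARC.Channel X11 X21 X12 X22 XR YR Y11 Y12)
    (d : HDMARC.InputDist X11 X21 X12 X22 XR YR YQ)
    (β : ℝ) (hβ0 : 0 < β) (hβ1 : β < 1)
    (R1 R2 : ℝ) (hR1 : 0 ≤ R1) (hR2 : 0 ≤ R2)
    (h1 : R1 < min (HDMARC.boundA1 ch d β) (HDMARC.boundB1 ch d β))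
    (h2 : R2 < min (HDMARC.boundA2 ch d β) (HDMARC.boundB2 ch d β))
    (h12 : R1 + R2 < min (HDMARC.boundC ch d β) (HDMARC.boundD ch d β)) :
    HDMARC.AchievableByGQF ch d β R1 R2 := by
  rw [lt_min_iff] at h1 h2 h12
  refine HDMARC.achievableByGQF_of_exponents ch d hβ0 hβ1 hR1 hR2 (fun i => ?_) fun i => ?_
  · fin_cases i
    · exact h1.1
    · exact h2.1
    · exact h12.1
  -- The term β I(Y_R; Ŷ_R) charged for the index rate cancels the one contained in `firstDiff` for
  -- a single source. For the sum rate it is the term that d₁ subtracts.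
  · fin_cases i
    · have h := h1.2
      simp only [HDMARC.boundB1] at h
      simp only [HDMARC.firstDiff, HDMARC.secondDiff, Fin.mk_zero, Matrix.cons_val]
      linarith
    · have h := h2.2
      simp only [HDMARC.boundB2] at h
      simp only [HDMARC.firstDiff, HDMARC.secondDiff, Fin.mk_one, Matrix.cons_val]
      linarith
    · have h := h12.2
      simp only [HDMARC.boundD] at h
      simp only [HDMARC.firstDiff, HDMARC.secondDiff, HDMARC.quantInfo, Fin.reduceFinMk, Matrix.cons_val]
      linarith
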